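/- Let $a,b\in C^0([0,1])$ be real functions with $a(0)=0$, $a>0$ on $(0,1]$ and $b/a\in L^1(0,1)$, and let $h\in L^\infty(0,1)$ with $h\ge 0$ a.e. Put $$\eta(x)=\exp\Big(\int_{1/2}^x \frac{b(s)}{a(s)}\,ds\Big),\qquad \sigma=\frac a\eta \qquad\text{on } [0,1].$$ Consider the spaces of complex-valued functions $$L^2_{1/\sigma}=\Big\{v:\int_0^1\tfrac1\sigma|v|^2dx<\infty\Big\},\qquad H^1_{1/\sigma,0}=L^2_{1/\sigma}\cap H^1_0(0,1),$$ $$H^2_{1/\sigma,0}=\{u\in H^1_{1/\sigma,0}:\ \sigma(\eta u_x)_x\in L^2_{1/\sigma}\},$$ derivatives being weak derivatives on $(0,1)$, and let $\mathcal H=H^1_{1/\sigma,0}\times L^2_{1/\sigma}$ carry the inner product $$\langle (u,v),(\tilde u,\tilde v)\rangle_{\mathcal H}=\int_0^1\Big(\eta\,u_x\overline{\tilde u_x}+\tfrac1\sigma v\overline{\tilde v}\Big)dx .$$ Define on $D(\mathcal A)=H^2_{1/\sigma,0}\times H^1_{1/\sigma,0}$ the operator $\mathcal A(u,v)=(v,\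 \sigma(\eta u_x)_x-hv)$. Theorem. 0. If $x\mapsto x^\alpha/a(x)$ is non-decreasing in a right neighbourhood of $0$ for some $\alpha\in(0,2)$ (as is the case when $a\in C^1((0,1])$ and $0<K:=\sup_{x\in(0,1]}x|a'(x)|/a(x)<2$, with $\alpha=K$), then $\mathcal H$ is a Hilbert space. 1. $\mathcal A$ is m-dissipative in $\mathcal H$: $\operatorname{Re}\langle \mathcal AU,U\rangle_{\mathcal H}\le 0$ for all $U\in D(\mathcal A)$, and $\mu I-\mathcal A:D(\mathcal A)\to\mathcal H$ is onto for every $\mu>0$. 2. $\mathcal A$ is the infinitesimal generator of a $C_0$-semigroup of contractions on $\mathcal H$. 3. For every $U_0\in\mathcal H$ the problem $U_t=\mathcal AU$, $U(0)=U_0$ has a unique weak solution $U\in C^0([0,\infty);\mathcal H)$, that is, a unique continuous $U$ with $U(0)=U_0$ such that for all $W\in D(\mathcal A^*)$ the function $t\mapsto\langle U(t),W\rangle_{\mathcal H}$ is differentiable on $[0,\infty)$ with derivative $\langle U(t),\mathcal A^*W\rangle_{\mathcal H}$. 4. For every $U_0\in D(\mathcal A)$ the problem has a unique strong solution $U\in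 C^1([0,\infty);\mathcal H)\cap C^0([0,\infty);D(\mathcal A))$, where $D(\mathcal A)$ carries the graph norm: $U(0)=U_0$ and $U'(t)=\mathcal AU(t)$ for all $t\ge 0$. -/

import Mathlib

open MeasureTheory Set Filter Topology
open scoped ENNReal NNReal ContDiff ComplexConjugate InnerProductSpace

noncomputable section

/-! ### Weak derivatives on the unit interval -/

/-- Lebesgue measure on the interval `(0,1)`. -/
abbrev leb01 : Measure ℝ := volume.restrict (Ioo 0 1)

/-- Test functions: smooth real functions with compact support contained in `(0,1)`. -/
structure IsTest01 (φ : ℝ → ℝ) : Prop where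
  smooth : ContDiff ℝ ∞ φ
  compact : HasCompactSupport φ
  subset : tsupport φ ⊆ Ioo 0 1

/-- `G ∈ L¹_loc(0,1)` is the weak derivative on `(0,1)` of `F ∈ L¹_loc(0,1)`. -/
structure HasWeakDeriv01 (F G : ℝ → ℂ) : Prop where
  locInt : LocallyIntegrableOn F (Ioo 0 1)
  locInt_deriv : LocallyIntegrableOn G (Ioo 0 1)
  integral_eq : ∀ φ : ℝ → ℝ, IsTest01 φ →
    ∫ x in Ioo 0 1, deriv φ x • F x = -∫ x in Ioo 0 1, φ x • G x

theorem IsTest01.deriv {φ : ℝ → ℝ} (h : IsTest01 φ) : IsTest01 (deriv φ) where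
  smooth := (contDiff_infty_iff_deriv.mp h.smooth).2
  compact := h.compact.deriv
  subset := (closure_minimal support_deriv_subset (isClosed_tsupport φ)).trans h.subset

theorem IsTest01.integrableOn_smul {φ : ℝ → ℝ} (h : IsTest01 φ) {F : ℝ → ℂ}
    (hF : LocallyIntegrableOn F (Ioo 0 1)) :
    IntegrableOn (fun x => φ x • F x) (Ioo 0 1) := by
  have h1 : IntegrableOn (fun x => φ x • F x) (tsupport φ) :=
    (hF.integrableOn_compact_subset h.subset h.compact).continuousOn_smul
      h.smooth.continuous.continuousOn h.compact
  have h2 : Integrable (fun x => φ x • F x) := by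
    refine (integrableOn_iff_integrable_of_support_subset ?_).mp h1
    intro x hx
    apply subset_tsupport φ
    rw [Function.mem_support] at hx ⊢
    intro h0
    simp [h0] at hx
  exact h2.integrableOn

theorem HasWeakDeriv01.add {F G F' G' : ℝ → ℂ} (h : HasWeakDeriv01 F G)
    (h' : HasWeakDeriv01 F' G') :
    HasWeakDeriv01 (fun x => F x + F' x) (fun x => G x + G' x) where
  locInt := h.locInt.add h'.locInt
  locInt_deriv := h.locInt_deriv.add h'.locInt_deriv
  integral_eq φ hφ := by
    simp only [smul_add]
    rw [integral_add (hφ.deriv.integrableOn_smul h.locInt)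
        (hφ.deriv.integrableOn_smul h'.locInt),
      integral_add (hφ.integrableOn_smul h.locInt_deriv)
        (hφ.integrableOn_smul h'.locInt_deriv),
      h.integral_eq φ hφ, h'.integral_eq φ hφ]
    ring

theorem HasWeakDeriv01.const_smul {F G : ℝ → ℂ} (h : HasWeakDeriv01 F G) (c : ℂ) :
    HasWeakDeriv01 (fun x => c * F x) (fun x => c * G x) where
  locInt := h.locInt.smul c
  locInt_deriv := h.locInt_deriv.smul c
  integral_eq φ hφ := by
    have e : ∀ (r : ℝ) (z : ℂ), r • (c * z) = c * r • z := fun r z => (mul_smul_comm r c z).symm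
    simp only [e]
    rw [integral_const_mul, integral_const_mul, h.integral_eq φ hφ]
    ring

theorem locallyIntegrableOn_congr01 {F G : ℝ → ℂ} (h : LocallyIntegrableOn F (Ioo 0 1))
    (hFG : F =ᵐ[leb01] G) : LocallyIntegrableOn G (Ioo 0 1) := by
  rw [locallyIntegrableOn_iff isOpen_Ioo.isLocallyClosed] at h ⊢
  intro K hK hc
  exact (h K hK hc).congr (ae_restrict_of_ae_restrict_of_subset hK hFG)

theorem HasWeakDeriv01.congr {F G F' G' : ℝ → ℂ} (h : HasWeakDeriv01 F G)
    (hF : F =ᵐ[leb01] F') (hG : G =ᵐ[leb01] G') : HasWeakDeriv01 F' G' where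
  locInt := locallyIntegrableOn_congr01 h.locInt hF
  locInt_deriv := locallyIntegrableOn_congr01 h.locInt_deriv hG
  integral_eq φ hφ := by
    have h1 : ∫ x in Ioo 0 1, deriv φ x • F' x = ∫ x in Ioo 0 1, deriv φ x • F x :=
      integral_congr_ae (hF.mono fun x hx => by simp only [hx])
    have h2 : ∫ x in Ioo 0 1, φ x • G' x = ∫ x in Ioo 0 1, φ x • G x :=
      integral_congr_ae (hG.mono fun x hx => by simp only [hx])
    rw [h1, h2, h.integral_eq φ hφ]

theorem hasWeakDeriv01_zero : HasWeakDeriv01 (fun _ => 0) (fun _ => 0) where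
  locInt := locallyIntegrableOn_zero
  locInt_deriv := locallyIntegrableOn_zero
  integral_eq φ _ := by simp

/-- A locally integrable function on `(0,1)` orthogonal to all test functions vanishes. -/
theorem ae_eq_zero_of_test01 {F : ℝ → ℂ} (hF : LocallyIntegrableOn F (Ioo 0 1))
    (h : ∀ φ : ℝ → ℝ, IsTest01 φ → ∫ x in Ioo 0 1, φ x • F x = 0) : F =ᵐ[leb01] 0 := by
  have key := isOpen_Ioo.ae_eq_zero_of_integral_contDiff_smul_eq_zero (μ := volume) hF
    (fun φ h1 h2 h3 => by
      rw [← h φ ⟨h1, h2, h3⟩]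
      refine (setIntegral_eq_integral_of_forall_compl_eq_zero fun x hx => ?_).symm
      rw [image_eq_zero_of_notMem_tsupport (fun hh => hx (h3 hh)), zero_smul])
  exact (ae_restrict_iff' measurableSet_Ioo).mpr key

/-- Uniqueness of the weak derivative. -/
theorem HasWeakDeriv01.unique {F G G' : ℝ → ℂ} (h : HasWeakDeriv01 F G)
    (h' : HasWeakDeriv01 F G') : G =ᵐ[leb01] G' := by
  have h0 := h.add (h'.const_smul (-1))
  have := ae_eq_zero_of_test01 h0.locInt_deriv (fun φ hφ => by
    have := h0.integral_eq φ hφ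
    have hz : ∀ x, F x + -1 * F x = 0 := fun x => by ring
    simp only [hz, smul_zero, integral_zero] at this
    exact neg_eq_zero.mp this.symm)
  filter_upwards [this] with x hx
  have : G x + -1 * G' x = 0 := hx
  linear_combination this

/-- A function on `(0,1)` with vanishing weak derivative is constant. -/
theorem HasWeakDeriv01.ae_const {F : ℝ → ℂ} (h : HasWeakDeriv01 F (fun _ => 0)) :
    ∃ c : ℂ, F =ᵐ[leb01] fun _ => c := by
  let ρ₀ : ContDiffBump (1 / 2 : ℝ) := ⟨1 / 8, 1 / 4, by norm_num, by norm_num⟩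
  let ρ : ℝ → ℝ := ρ₀.normed volume
  have hρ : IsTest01 ρ := by
    refine ⟨ρ₀.contDiff_normed, ρ₀.hasCompactSupport_normed, ?_⟩
    rw [ρ₀.tsupport_normed_eq]
    intro x hx
    rw [Metric.mem_closedBall, Real.dist_eq, abs_le] at hx
    have : ρ₀.rOut = 1 / 4 := rfl
    rw [this] at hx
    constructor <;> linarith [hx.1, hx.2]
  have hρ1 : ∫ x, ρ x = 1 := ρ₀.integral_normed
  let c : ℂ := ∫ x in Ioo 0 1, ρ x • F x
  have hc : LocallyIntegrableOn (fun _ : ℝ => c) (Ioo 0 1) := locallyIntegrableOn_const c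
  refine ⟨c, ?_⟩
  have main : (fun x => F x + -1 * c) =ᵐ[leb01] 0 := by
    refine ae_eq_zero_of_test01 (h.locInt.add (locallyIntegrableOn_const (-1 * c)))
      fun ψ hψ => ?_
    have hψi : Integrable ψ := hψ.smooth.continuous.integrable_of_hasCompactSupport hψ.compact
    have hρi : Integrable ρ := hρ.smooth.continuous.integrable_of_hasCompactSupport hρ.compact
    let m : ℝ := ∫ x, ψ x
    let f : ℝ → ℝ := fun x => ψ x - m * ρ x
    have hfs : ContDiff ℝ ∞ f := hψ.smooth.sub (contDiff_const.mul hρ.smooth)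
    have hf0 : ∫ x, f x = 0 := by
      simp only [f]
      rw [integral_sub hψi (hρi.const_mul m), integral_const_mul, hρ1]
      simp [m]
    -- the support of `f` lies in a compact subinterval of `(0,1)`
    obtain ⟨α, β, hα, hβ, hsupp⟩ : ∃ α β : ℝ, 0 < α ∧ β < 1 ∧ Function.support f ⊆ Icc α β := by
      have hK : IsCompact (insert (1 / 2 : ℝ) (tsupport ψ ∪ tsupport ρ)) :=
        (hψ.compact.isCompact.union hρ.compact.isCompact).insert _
      have hKs : insert (1 / 2 : ℝ) (tsupport ψ ∪ tsupport ρ) ⊆ Ioo 0 1 := by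
        intro x hx
        rcases hx with rfl | hx | hx
        · norm_num
        · exact hψ.subset hx
        · exact hρ.subset hx
      obtain ⟨α, hα⟩ := hK.exists_isLeast ⟨_, mem_insert _ _⟩
      obtain ⟨β, hβ⟩ := hK.exists_isGreatest ⟨_, mem_insert _ _⟩
      refine ⟨α, β, (hKs hα.1).1, (hKs hβ.1).2, fun x hx => ?_⟩
      have hxK : x ∈ insert (1 / 2 : ℝ) (tsupport ψ ∪ tsupport ρ) := by
        by_contra hn
        apply hx
        have h1 : x ∉ tsupport ψ := fun hh => hn (Or.inr (Or.inl hh))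
        have h2 : x ∉ tsupport ρ := fun hh => hn (Or.inr (Or.inr hh))
        simp only [f]
        rw [image_eq_zero_of_notMem_tsupport h1, image_eq_zero_of_notMem_tsupport h2]
        simp
      exact ⟨hα.2 hxK, hβ.2 hxK⟩
    let Φ : ℝ → ℝ := fun x => ∫ t in (0 : ℝ)..x, f t
    have hΦd : ∀ x, HasDerivAt Φ (f x) x := fun x =>
      (hfs.continuous.integral_hasStrictDerivAt 0 x).hasDerivAt
    have hΦd' : deriv Φ = f := funext fun x => (hΦd x).deriv
    have hΦs : Function.support Φ ⊆ Icc α β := by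
      intro x hx
      by_contra hn
      apply hx
      rw [mem_Icc, not_and_or, not_le, not_le] at hn
      rcases hn with hn | hn
      · refine intervalIntegral.integral_zero_ae (ae_of_all _ fun t ht => ?_)
        by_contra hft
        have := (hsupp hft).1
        rcases le_total 0 x with h0 | h0
        · rw [uIoc_of_le h0] at ht
          linarith [ht.2]
        · rw [uIoc_of_ge h0] at ht
          linarith [ht.2]
      · have : Φ x = ∫ t, f t := by
          refine intervalIntegral.integral_eq_integral_of_support_subset fun t ht => ?_
          have := hsupp ht
          exact ⟨lt_of_lt_of_le hα this.1, this.2.trans hn.le⟩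
        rw [this, hf0]
    have hΦ : IsTest01 Φ := by
      refine ⟨?_, ?_, ?_⟩
      · rw [contDiff_infty_iff_deriv]
        exact ⟨fun x => (hΦd x).differentiableAt, hΦd' ▸ hfs⟩
      · exact HasCompactSupport.of_support_subset_isCompact isCompact_Icc hΦs
      · exact (closure_minimal hΦs isClosed_Icc).trans
          fun x hx => ⟨lt_of_lt_of_le hα hx.1, lt_of_le_of_lt hx.2 hβ⟩
    have e1 := h.integral_eq Φ hΦ
    simp only [hΦd', smul_zero, integral_zero, neg_zero, f, sub_smul, mul_smul] at e1
    have hi : IntegrableOn (fun x => m • ρ x • F x) (Ioo 0 1) :=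
      (hρ.integrableOn_smul h.locInt).smul m
    rw [integral_sub (hψ.integrableOn_smul h.locInt) hi, integral_smul] at e1
    have e2 : ∫ x in Ioo 0 1, ψ x • (-1 * c) = m • (-1 * c) := by
      rw [integral_smul_const]
      congr 1
      exact setIntegral_eq_integral_of_forall_compl_eq_zero fun x hx =>
        image_eq_zero_of_notMem_tsupport fun hh => hx (hψ.subset hh)
    simp only [smul_add]
    rw [integral_add (hψ.integrableOn_smul h.locInt)
      (hψ.integrableOn_smul (locallyIntegrableOn_const (-1 * c))), e2]
    have e3 : ∫ x in Ioo 0 1, ψ x • F x = m • c := sub_eq_zero.mp e1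
    rw [e3]
    simp
  filter_upwards [main] with x hx
  have : F x + -1 * c = 0 := hx
  linear_combination this

/-! ### The degenerate damped wave equation: coefficients, weights, function spaces -/

/-- Coefficients of the equation `u_tt - a u_xx - b u_x + h u_t = 0` on `(0,1)`, which
degenerates at `x = 0`. -/
structure DegenerateWave where
  /-- diffusion coefficient -/
  a : ℝ → ℝ
  /-- drift coefficient -/
  b : ℝ → ℝ
  /-- damping coefficient -/
  h : ℝ → ℝ
  a_cont : ContinuousOn a (Icc 0 1)
  b_cont : ContinuousOn b (Icc 0 1)
  a_zero : a 0 = 0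
  a_pos : ∀ x ∈ Ioc (0 : ℝ) 1, 0 < a x
  b_div_a : IntegrableOn (fun x => b x / a x) (Ioo 0 1)
  h_nonneg : ∀ᵐ x ∂leb01, 0 ≤ h x
  h_bdd : MemLp h ∞ leb01

namespace DegenerateWave

variable (D : DegenerateWave)

/-- The weight `η(x) = exp (∫_{1/2}^x b/a)`. -/
def eta (x : ℝ) : ℝ := Real.exp (∫ s in (1 / 2 : ℝ)..x, D.b s / D.a s)

/-- The weight `σ = a / η`. -/
def sigma (x : ℝ) : ℝ := D.a x / D.eta x

/-- The measure `dx / σ` on `(0,1)`. -/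
def weight : Measure ℝ := leb01.withDensity fun x => ENNReal.ofReal (1 / D.sigma x)

/-- The space `L²_{1/σ}(0,1)` (since `σ` is bounded, it is contained in `L²(0,1)`). -/
abbrev L2w : Type := Lp ℂ 2 D.weight

theorem eta_pos (x : ℝ) : 0 < D.eta x := Real.exp_pos _

theorem eta_cont : ContinuousOn D.eta (Icc 0 1) := by
  have h1 : IntervalIntegrable (fun x => D.b x / D.a x) volume 0 1 := by
    rw [intervalIntegrable_iff_integrableOn_Ioo_of_le zero_le_one]
    exact D.b_div_a
  have h2 := intervalIntegral.continuousOn_primitive_interval' h1 (a := 1 / 2)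
    (by rw [uIcc_of_le zero_le_one]; norm_num)
  rw [uIcc_of_le zero_le_one] at h2
  exact Real.continuous_exp.comp_continuousOn h2

theorem sigma_pos {x : ℝ} (hx : x ∈ Ioo (0 : ℝ) 1) : 0 < D.sigma x :=
  div_pos (D.a_pos x ⟨hx.1, hx.2.le⟩) (D.eta_pos x)

theorem sigma_cont : ContinuousOn D.sigma (Icc 0 1) :=
  D.a_cont.div D.eta_cont fun x _ => (D.eta_pos x).ne'

theorem weight_ac : D.weight ≪ leb01 := withDensity_absolutelyContinuous _ _

theorem ac_weight : leb01 ≪ D.weight := by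
  refine withDensity_absolutelyContinuous' ?_ ?_
  · refine ENNReal.measurable_ofReal.comp_aemeasurable ?_
    have : ContinuousOn (fun x => 1 / D.sigma x) (Ioo 0 1) :=
      continuousOn_const.div (D.sigma_cont.mono Ioo_subset_Icc_self)
        fun x hx => (D.sigma_pos hx).ne'
    exact this.aemeasurable measurableSet_Ioo
  · filter_upwards [ae_restrict_mem measurableSet_Ioo] with x hx
    simpa using D.sigma_pos hx

/-- `u` is the class of a function in `H¹₀(0,1)` with weak derivative `g ∈ L²(0,1)`: the
continuous representative of `u` on `[0,1]` vanishes at `0` and at `1`. -/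
def HasH10Deriv (u : D.L2w) (g : Lp ℂ 2 leb01) : Prop :=
  HasWeakDeriv01 u g ∧
    ∃ w : ℝ → ℂ, ContinuousOn w (Icc 0 1) ∧ w =ᵐ[leb01] u ∧ w 0 = 0 ∧ w 1 = 0

variable {D}

theorem coe_add_ae (u v : D.L2w) : (fun x => u x + v x) =ᵐ[leb01] ((u + v : D.L2w) : ℝ → ℂ) :=
  (D.ac_weight.ae_eq (Lp.coeFn_add u v)).symm

theorem coe_smul_ae (c : ℂ) (u : D.L2w) :
    (fun x => c * u x) =ᵐ[leb01] ((c • u : D.L2w) : ℝ → ℂ) :=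
  (D.ac_weight.ae_eq (Lp.coeFn_smul c u)).symm

theorem HasH10Deriv.add {u v : D.L2w} {g k : Lp ℂ 2 leb01} (hu : D.HasH10Deriv u g)
    (hv : D.HasH10Deriv v k) : D.HasH10Deriv (u + v) (g + k) := by
  obtain ⟨h1, w, hw, hwu, hw0, hw1⟩ := hu
  obtain ⟨h2, z, hz, hzv, hz0, hz1⟩ := hv
  refine ⟨(h1.add h2).congr (coe_add_ae u v) (Lp.coeFn_add g k).symm,
    fun x => w x + z x, hw.add hz, ?_, by simp [hw0, hz0], by simp [hw1, hz1]⟩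
  filter_upwards [hwu, hzv, coe_add_ae u v] with x e1 e2 e3
  rw [← e3, e1, e2]

theorem HasH10Deriv.smul {u : D.L2w} {g : Lp ℂ 2 leb01} (hu : D.HasH10Deriv u g) (c : ℂ) :
    D.HasH10Deriv (c • u) (c • g) := by
  obtain ⟨h1, w, hw, hwu, hw0, hw1⟩ := hu
  refine ⟨(h1.const_smul c).congr (coe_smul_ae c u) (Lp.coeFn_smul c g).symm,
    fun x => c * w x, continuousOn_const.mul hw, ?_, by simp [hw0], by simp [hw1]⟩
  filter_upwards [hwu, coe_smul_ae c u] with x e1 e3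
  rw [← e3, e1]

theorem HasH10Deriv.zero : D.HasH10Deriv 0 0 :=
  ⟨hasWeakDeriv01_zero.congr (D.ac_weight.ae_eq (Lp.coeFn_zero ℂ 2 D.weight)).symm
      (Lp.coeFn_zero ℂ 2 leb01).symm,
    fun _ => 0, continuousOn_const, (D.ac_weight.ae_eq (Lp.coeFn_zero ℂ 2 D.weight)).symm, rfl, rfl⟩

theorem HasH10Deriv.unique {u : D.L2w} {g k : Lp ℂ 2 leb01} (hg : D.HasH10Deriv u g)
    (hk : D.HasH10Deriv u k) : g = k :=
  Lp.ext (hg.1.unique hk.1)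

theorem HasH10Deriv.eq_zero {u : D.L2w} (hu : D.HasH10Deriv u 0) : u = 0 := by
  obtain ⟨h1, w, hw, hwu, hw0, -⟩ := hu
  obtain ⟨c, hc⟩ := (h1.congr (EventuallyEq.refl _ _) (Lp.coeFn_zero ℂ 2 leb01)).ae_const
  have hwc : EqOn w (fun _ => c) (Icc 0 1) :=
    Measure.eqOn_Icc_of_ae_eq volume zero_ne_one
      (Measure.restrict_congr_set (μ := (volume : Measure ℝ)) (Ioo_ae_eq_Icc (a := 0) (b := 1)) ▸
        hwu.trans hc) hw continuousOn_const
  have hc0 : c = 0 := by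
    have := hwc (left_mem_Icc.mpr zero_le_one)
    exact this.symm.trans hw0
  refine Lp.ext (D.weight_ac.ae_eq ?_)
  have h0 := D.ac_weight.ae_eq (Lp.coeFn_zero ℂ 2 D.weight)
  filter_upwards [hc, h0] with x e1 e2
  rw [e1, e2, hc0]
  rfl

variable (D)

/-- The space `H¹_{1/σ,0}(0,1) = L²_{1/σ}(0,1) ∩ H¹₀(0,1)`, as a subspace of `L²_{1/σ}(0,1)`. -/
def H1zero : Submodule ℂ D.L2w where
  carrier := {u | ∃ g, D.HasH10Deriv u g}
  add_mem' := fun ⟨g, hg⟩ ⟨k, hk⟩ => ⟨g + k, hg.add hk⟩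
  zero_mem' := ⟨0, HasH10Deriv.zero⟩
  smul_mem' := fun c _ ⟨g, hg⟩ => ⟨c • g, hg.smul c⟩

/-- The space `H¹_{1/σ,0}(0,1)`, to be normed by `‖u‖² = ∫ η |u_x|²`. -/
def V : Type := D.H1zero

instance : AddCommGroup D.V := inferInstanceAs (AddCommGroup D.H1zero)

instance : Module ℂ D.V := inferInstanceAs (Module ℂ D.H1zero)

/-- The inclusion `H¹_{1/σ,0}(0,1) → L²_{1/σ}(0,1)`. -/
def incl : D.V →ₗ[ℂ] D.L2w := D.H1zero.subtype

/-- An element of the subspace `H¹_{1/σ,0}(0,1)` of `L²_{1/σ}(0,1)`, viewed in `V`. -/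
def toV : D.H1zero →ₗ[ℂ] D.V := LinearMap.id

theorem exists_deriv (u : D.V) : ∃ g, D.HasH10Deriv (D.incl u) g := u.2

/-- The weak derivative `u ↦ u_x`, from `H¹_{1/σ,0}(0,1)` to `L²(0,1)`. -/
def dx : D.V →ₗ[ℂ] Lp ℂ 2 leb01 where
  toFun u := (D.exists_deriv u).choose
  map_add' u v := (D.exists_deriv (u + v)).choose_spec.unique
    ((map_add D.incl u v).symm ▸ (D.exists_deriv u).choose_spec.add (D.exists_deriv v).choose_spec)
  map_smul' c u := (D.exists_deriv (c • u)).choose_spec.unique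
    ((map_smul D.incl c u).symm ▸ (D.exists_deriv u).choose_spec.smul c)

theorem dx_spec (u : D.V) : D.HasH10Deriv (D.incl u) (D.dx u) := (D.exists_deriv u).choose_spec

theorem eta_memLp : MemLp (fun x => (D.eta x : ℂ)) ∞ leb01 := by
  obtain ⟨C, hC⟩ := isCompact_Icc.exists_bound_of_continuousOn D.eta_cont
  refine memLp_top_of_bound ?_ C ?_
  · exact ((Complex.continuous_ofReal.comp_continuousOn
      (D.eta_cont.mono Ioo_subset_Icc_self)).aestronglyMeasurable measurableSet_Ioo)
  · filter_upwards [ae_restrict_mem measurableSet_Ioo] with x hx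
    simpa using hC x (Ioo_subset_Icc_self hx)

theorem integrable_eta (g k : Lp ℂ 2 leb01) :
    Integrable (fun x => (D.eta x : ℂ) * (conj (g x) * k x)) leb01 := by
  have h1 : Integrable (fun x => conj (g x) * k x) leb01 :=
    MemLp.integrable_mul (Lp.memLp g).star (Lp.memLp k)
  have h2 : MemLp (fun x => (D.eta x : ℂ) * (conj (g x) * k x)) 1 leb01 :=
    (memLp_one_iff_integrable.mpr h1).smul D.eta_memLp
  exact memLp_one_iff_integrable.mp h2

/-- The inner product `∫₀¹ η u_x w̄_x dx` of `H¹_{1/σ,0}(0,1)` (conjugate linear in the first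
argument, as usual in Mathlib). -/
def innerV (u w : D.V) : ℂ :=
  ∫ x in Ioo 0 1, (D.eta x : ℂ) * (conj (D.dx u x) * D.dx w x)

theorem innerV_self (u : D.V) :
    D.innerV u u = ((∫ x in Ioo 0 1, D.eta x * ‖D.dx u x‖ ^ 2 : ℝ) : ℂ) := by
  rw [innerV, ← integral_complex_ofReal]
  refine integral_congr_ae (ae_of_all _ fun x => ?_)
  simp only [Complex.conj_mul']
  push_cast
  rfl

/-- The inner product structure of `H¹_{1/σ,0}(0,1)`. -/
abbrev core : InnerProductSpace.Core ℂ D.V where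
  inner := D.innerV
  conj_inner_symm u w := by
    simp only [innerV]
    rw [← integral_conj]
    refine integral_congr_ae (ae_of_all _ fun x => ?_)
    simp only [map_mul, Complex.conj_conj, Complex.conj_ofReal]
    ring
  re_inner_nonneg u := by
    rw [innerV_self]
    rw [RCLike.re_to_complex, Complex.ofReal_re]
    exact integral_nonneg fun x => mul_nonneg (D.eta_pos x).le (by positivity)
  add_left u v w := by
    simp only [innerV]
    rw [← integral_add (D.integrable_eta _ _) (D.integrable_eta _ _), map_add]
    refine integral_congr_ae ?_
    filter_upwards [Lp.coeFn_add (D.dx u) (D.dx v)] with x hx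
    simp only [hx, Pi.add_apply, map_add]
    ring
  smul_left u w c := by
    simp only [innerV]
    rw [← integral_const_mul, map_smul]
    refine integral_congr_ae ?_
    filter_upwards [Lp.coeFn_smul c (D.dx u)] with x hx
    simp only [hx, Pi.smul_apply, smul_eq_mul, map_mul]
    ring
  definite u hu := by
    change D.innerV u u = 0 at hu
    rw [innerV_self, Complex.ofReal_eq_zero] at hu
    have hi : Integrable (fun x => D.eta x * ‖D.dx u x‖ ^ 2) leb01 := by
      refine (D.integrable_eta (D.dx u) (D.dx u)).re.congr (ae_of_all _ fun x => ?_)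
      simp only [Complex.conj_mul']
      norm_cast
    rw [integral_eq_zero_iff_of_nonneg
      (fun x => mul_nonneg (D.eta_pos x).le (by positivity)) hi] at hu
    have h0 : D.dx u = 0 := by
      refine Lp.ext ?_
      filter_upwards [hu, Lp.coeFn_zero ℂ 2 leb01] with x e1 e2
      rw [e2]
      have : D.eta x * ‖D.dx u x‖ ^ 2 = 0 := e1
      simpa [(D.eta_pos x).ne'] using this
    have h1 := D.dx_spec u
    rw [h0] at h1
    exact Subtype.ext h1.eq_zero

instance : NormedAddCommGroup D.V := D.core.toNormedAddCommGroup

instance : InnerProductSpace ℂ D.V := InnerProductSpace.ofCore D.core.toCore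

theorem inner_V (u w : D.V) : ⟪u, w⟫_ℂ = D.innerV u w := rfl

/-- The energy space `H¹_{1/σ,0}(0,1) × L²_{1/σ}(0,1)`, with the inner product
`∫₀¹ (η u_x ũ_x + (1/σ) v ṽ) dx` (one factor conjugated). -/
abbrev Energy : Type := WithLp 2 (D.V × D.L2w)

theorem inner_energy (U W : D.Energy) :
    ⟪U, W⟫_ℂ = D.innerV U.fst W.fst + ⟪U.snd, W.snd⟫_ℂ := rfl

/-! ### The wave operator -/

/-- `B u = σ (η u_x)_x = f` for a function `f` in `L²_{1/σ}(0,1)`, in the weak sense. -/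
def HasB (u : D.V) (f : D.L2w) : Prop :=
  HasWeakDeriv01 (fun x => (D.eta x : ℂ) * D.dx u x) (fun x => f x / (D.sigma x : ℂ))

variable {D}

theorem HasB.add {u v : D.V} {f k : D.L2w} (hf : D.HasB u f) (hk : D.HasB v k) :
    D.HasB (u + v) (f + k) := by
  refine (HasWeakDeriv01.add hf hk).congr ?_ ?_
  · rw [map_add]
    filter_upwards [Lp.coeFn_add (D.dx u) (D.dx v)] with x hx
    rw [hx, Pi.add_apply]
    ring
  · filter_upwards [coe_add_ae f k] with x hx
    rw [← hx]
    ring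

theorem HasB.smul {u : D.V} {f : D.L2w} (hf : D.HasB u f) (c : ℂ) : D.HasB (c • u) (c • f) := by
  refine (HasWeakDeriv01.const_smul hf c).congr ?_ ?_
  · rw [map_smul]
    filter_upwards [Lp.coeFn_smul c (D.dx u)] with x hx
    rw [hx, Pi.smul_apply, smul_eq_mul]
    ring
  · filter_upwards [coe_smul_ae c f] with x hx
    rw [← hx]
    ring

theorem HasB.zero : D.HasB 0 0 := by
  refine hasWeakDeriv01_zero.congr ?_ ?_
  · rw [map_zero]
    filter_upwards [Lp.coeFn_zero ℂ 2 leb01] with x hx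
    rw [hx, Pi.zero_apply, mul_zero]
  · filter_upwards [D.ac_weight.ae_eq (Lp.coeFn_zero ℂ 2 D.weight)] with x hx
    rw [hx, Pi.zero_apply, zero_div]

theorem HasB.unique {u : D.V} {f k : D.L2w} (hf : D.HasB u f) (hk : D.HasB u k) : f = k := by
  refine Lp.ext (D.weight_ac.ae_eq ?_)
  filter_upwards [HasWeakDeriv01.unique hf hk, ae_restrict_mem measurableSet_Ioo] with x hx hx'
  have : (D.sigma x : ℂ) ≠ 0 := by exact_mod_cast (D.sigma_pos hx').ne'
  exact (div_left_inj' this).mp hx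

variable (D)

/-- The space `H²_{1/σ,0}(0,1) = {u ∈ H¹_{1/σ,0}(0,1) : B u ∈ L²_{1/σ}(0,1)}`. -/
def H2zero : Submodule ℂ D.V where
  carrier := {u | ∃ f, D.HasB u f}
  add_mem' := fun ⟨f, hf⟩ ⟨k, hk⟩ => ⟨f + k, hf.add hk⟩
  zero_mem' := ⟨0, HasB.zero⟩
  smul_mem' := fun c _ ⟨f, hf⟩ => ⟨c • f, hf.smul c⟩

/-- The operator `B u = σ (η u_x)_x` with domain `H²_{1/σ,0}(0,1)`. -/
def B : D.H2zero →ₗ[ℂ] D.L2w where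
  toFun u := u.2.choose
  map_add' u v := (u + v).2.choose_spec.unique (u.2.choose_spec.add v.2.choose_spec)
  map_smul' c u := (c • u).2.choose_spec.unique (u.2.choose_spec.smul c)

theorem B_spec (u : D.H2zero) : D.HasB u (D.B u) := u.2.choose_spec

theorem h_memLp : MemLp (fun x => (D.h x : ℂ)) ∞ D.weight := by
  have h1 : MemLp (fun x => (D.h x : ℂ)) ∞ leb01 := D.h_bdd.ofReal
  refine ⟨h1.1.mono_ac D.weight_ac, ?_⟩
  have h2 := h1.2
  rw [eLpNorm_exponent_top] at h2 ⊢
  exact (eLpNormEssSup_mono_measure _ D.weight_ac).trans_lt h2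

theorem mulH_memLp (v : D.L2w) : MemLp (fun x => (D.h x : ℂ) * v x) 2 D.weight :=
  MemLp.smul (φ := fun x => (D.h x : ℂ)) (Lp.memLp v) D.h_memLp

/-- Multiplication by the damping coefficient on `L²_{1/σ}(0,1)`. -/
def mulH : D.L2w →ₗ[ℂ] D.L2w where
  toFun v := (D.mulH_memLp v).toLp _
  map_add' u v := by
    rw [← MemLp.toLp_add, MemLp.toLp_eq_toLp_iff]
    filter_upwards [Lp.coeFn_add u v] with x hx
    simp only [hx, Pi.add_apply]
    ring
  map_smul' c v := by
    rw [RingHom.id_apply, ← MemLp.toLp_const_smul, MemLp.toLp_eq_toLp_iff]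
    filter_upwards [Lp.coeFn_smul c v] with x hx
    simp only [hx, Pi.smul_apply, smul_eq_mul]
    ring

/-- The domain `H²_{1/σ,0}(0,1) × H¹_{1/σ,0}(0,1)` of the wave operator. -/
def domA : Submodule ℂ D.Energy where
  carrier := {U | U.fst ∈ D.H2zero ∧ U.snd ∈ D.H1zero}
  add_mem' hU hW := ⟨D.H2zero.add_mem hU.1 hW.1, D.H1zero.add_mem hU.2 hW.2⟩
  zero_mem' := ⟨D.H2zero.zero_mem, D.H1zero.zero_mem⟩
  smul_mem' c _ hU := ⟨D.H2zero.smul_mem c hU.1, D.H1zero.smul_mem c hU.2⟩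

/-- The first component `(u, v) ↦ u` on the domain of the wave operator. -/
def domFst : D.domA →ₗ[ℂ] D.H2zero where
  toFun U := ⟨U.1.fst, U.2.1⟩
  map_add' _ _ := rfl
  map_smul' _ _ := rfl

/-- The second component `(u, v) ↦ v` on the domain of the wave operator. -/
def domSnd : D.domA →ₗ[ℂ] D.H1zero where
  toFun U := ⟨U.1.snd, U.2.2⟩
  map_add' _ _ := rfl
  map_smul' _ _ := rfl

/-- The wave operator `A (u, v) = (v, σ (η u_x)_x - h v)`, an unbounded operator on the
energy space. -/
def A : D.Energy →ₗ.[ℂ] D.Energy where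
  domain := D.domA
  toFun := (WithLp.linearEquiv 2 ℂ (D.V × D.L2w)).symm.toLinearMap ∘ₗ
    LinearMap.prod (D.toV ∘ₗ D.domSnd)
      (D.B ∘ₗ D.domFst - D.mulH ∘ₗ D.H1zero.subtype ∘ₗ D.domSnd)

theorem A_apply (U : D.domA) :
    D.A U = WithLp.toLp 2 (D.toV (D.domSnd U), D.B (D.domFst U) - D.mulH (U : D.Energy).snd) :=
  rfl

end DegenerateWave

/-! ### Dissipative operators, semigroups and evolution equations -/

section Evolution

variable {E : Type*} [NormedAddCommGroup E] [InnerProductSpace ℂ E]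

/-- `A` is dissipative: `Re ⟨A U, U⟩ ≤ 0` on the domain. -/
def IsDissipative (A : E →ₗ.[ℂ] E) : Prop :=
  ∀ U : A.domain, (⟪(U : E), A U⟫_ℂ).re ≤ 0

/-- `A` is m-dissipative: it is dissipative and `μ I - A` is onto for every `μ > 0`. -/
def IsMDissipative (A : E →ₗ.[ℂ] E) : Prop :=
  IsDissipative A ∧ ∀ μ : ℝ, 0 < μ → ∀ F : E, ∃ U : A.domain, (μ : ℂ) • (U : E) - A U = F

/-- `T` is a strongly continuous semigroup of contractions. -/
structure IsContractionSemigroup (T : ℝ≥0 → E →L[ℂ] E) : Prop where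
  zero : T 0 = ContinuousLinearMap.id ℂ E
  add : ∀ s t, T (s + t) = (T s).comp (T t)
  norm_le : ∀ t, ‖T t‖ ≤ 1
  continuous : ∀ U : E, Continuous fun t => T t U

/-- `A` is the infinitesimal generator of `T`: its domain is exactly the set of `U` for which
`(T(t) U - U) / t` has a limit as `t → 0+`, and `A U` is this limit. -/
def IsGenerator (A : E →ₗ.[ℂ] E) (T : ℝ≥0 → E →L[ℂ] E) : Prop :=
  ∀ U F : E, (U, F) ∈ A.graph ↔
    Tendsto (fun t : ℝ≥0 => ((t : ℝ)⁻¹ : ℂ) • (T t U - U)) (𝓝[>] 0) (𝓝 F)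

/-- `Z = A* W`, i.e. `⟨A V, W⟩ = ⟨V, Z⟩` for all `V` in the domain of `A`. -/
def IsAdjointPair (A : E →ₗ.[ℂ] E) (W Z : E) : Prop :=
  ∀ V : A.domain, ⟪W, A V⟫_ℂ = ⟪Z, (V : E)⟫_ℂ

/-- Weak solutions on `[0,∞)` of `U_t = A U`, `U(0) = U₀`: `U` is continuous, and for all `W` in
the domain of `A*` the function `⟨U(t), W⟩` is differentiable with derivative `⟨U(t), A* W⟩`. -/
structure IsWeakSolution (A : E →ₗ.[ℂ] E) (U₀ : E) (U : ℝ → E) : Prop where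
  init : U 0 = U₀
  cont : ContinuousOn U (Ici 0)
  weak : ∀ W Z : E, IsAdjointPair A W Z → ∀ t : ℝ, 0 ≤ t →
    HasDerivWithinAt (fun s => ⟪W, U s⟫_ℂ) ⟪Z, U t⟫_ℂ (Ici 0) t

/-- Strong solutions on `[0,∞)` of `U_t = A U`, `U(0) = U₀`: `U` takes values in the domain of
`A`, is continuous there for the graph norm, is `C¹` with values in `E`, and solves the equation
for every `t ≥ 0`. -/
structure IsStrongSolution (A : E →ₗ.[ℂ] E) (U₀ : E) (U : ℝ → E) : Prop where
  init : U 0 = U₀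
  mem : ∀ t : ℝ, 0 ≤ t → U t ∈ A.domain
  cont : ContinuousOn U (Ici 0)
  cont_A : Continuous fun t : Ici (0 : ℝ) => A ⟨U t, mem t t.2⟩
  deriv : ∀ (t : ℝ) (ht : 0 ≤ t), HasDerivWithinAt U (A ⟨U t, mem t ht⟩) (Ici 0) t

end Evolution

end

/-! The difficulty is that the energy space may be incomplete. Its norm controls `u` only through `∫
η |u_x|²`, and without a growth condition on `1 / σ` this does not control the norm of `u` in
`L²_{1/σ}`. Lumer–Phillips is therefore applied in a finer, complete norm, and the result is carried
back to the energy norm.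

Dissipativity and the resolvent equation both rest on Green's formula `∫ η v̄_x u_x = -⟨v, Bu⟩`
(`HasB.innerV_eq`). The boundary term at `1` vanishes because `v(1) = 0`. At the degenerate end
`|v(x)|² ≤ x ‖v_x‖²`, while `η u_x` is square integrable; a nonzero limit of `v̄ η u_x` would make
`1 / x` integrable (`tendsto_zero_of_mul_sq_integrable`). So `Re ⟨AU, U⟩ = -∫ h |v|² / σ ≤ 0`.
Eliminating `v = μ u - f` from `μ U - A U = (f, g)` leaves a coercive problem for `u`, solved by
Lax–Milgram in `H¹_{1/σ,0}` with the norm `‖u_x‖² + ‖u‖²`, which is complete because weak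
differentiation is closed (`exists_tendsto_V`).

For generation, `‖u‖²` in `L²_{1/σ}` is added to the energy. This norm is complete, and since the
first component of `A(u, v)` is `v`, the operator `A - 1` is m-dissipative for it. Yosida
approximation gives a semigroup there. Its rescaled orbits from the domain solve `U' = A U` also in
the energy norm, where dissipativity makes them contract; density extends this to all data
(`IsMDissipative.exists_semigroup_of_finer_norm`).

Uniqueness of weak solutions is a duality argument. Reversing the velocity turns `A` into a
restriction of its adjoint, so the semigroup itself supplies enough backward adjoint solutions, and
no adjoint semigroup on a Hilbert space is needed.

Under the monotonicity condition `∫ x / σ` is finite. The bound `|u(x)|² ≤ x ‖u_x‖²` then makes the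
two norms equivalent, whence completeness. -/

/-! ### Dissipative operators, generators and the Cauchy problem. -/

section Semigroup

variable {E : Type*} [NormedAddCommGroup E] [InnerProductSpace ℂ E]

/-- Pointwise convergence of contractions passes from a dense set to the whole space. -/
theorem tendsto_of_dense_of_norm_le {ι : Type*} {l : Filter ι} {L : ι → E →L[ℂ] E}
    {M : E →L[ℂ] E} {s : Set E} (hs : Dense s) (hL : ∀ i x, ‖L i x‖ ≤ ‖x‖)
    (hM : ∀ x, ‖M x‖ ≤ ‖x‖) (h : ∀ x ∈ s, Tendsto (fun i => L i x) l (𝓝 (M x))) (x : E) :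
    Tendsto (fun i => L i x) l (𝓝 (M x)) := by
  rw [Metric.tendsto_nhds]
  intro ε hε
  obtain ⟨y, hy, hxy⟩ := Metric.mem_closure_iff.mp (hs x) (ε / 3) (by positivity)
  filter_upwards [Metric.tendsto_nhds.mp (h y hy) (ε / 3) (by positivity)] with i hi
  rw [dist_eq_norm] at *
  have e : L i x - M x = L i (x - y) + (L i y - M y) - M (x - y) := by
    simp only [map_sub]; abel
  rw [e]
  have h1 := norm_sub_le (L i (x - y) + (L i y - M y)) (M (x - y))
  have h2 := norm_add_le (L i (x - y)) (L i y - M y)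
  linarith [hL i (x - y), hM (x - y)]

theorem cauchySeq_of_dense_of_norm_le {L : ℕ → E →L[ℂ] E} {s : Set E} (hs : Dense s)
    (hL : ∀ i x, ‖L i x‖ ≤ ‖x‖) (h : ∀ x ∈ s, CauchySeq fun i => L i x) (x : E) :
    CauchySeq fun i => L i x := by
  rw [Metric.cauchySeq_iff]
  intro ε hε
  obtain ⟨y, hy, hxy⟩ := Metric.mem_closure_iff.mp (hs x) (ε / 3) (by positivity)
  obtain ⟨N, hN⟩ := Metric.cauchySeq_iff.mp (h y hy) (ε / 3) (by positivity)
  refine ⟨N, fun m hm n hn => ?_⟩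
  have h0 := hN m hm n hn
  rw [dist_eq_norm] at *
  have e : L m x - L n x = L m (x - y) + (L m y - L n y) - L n (x - y) := by
    simp only [map_sub]; abel
  rw [e]
  have h1 := norm_sub_le (L m (x - y) + (L m y - L n y)) (L n (x - y))
  have h2 := norm_add_le (L m (x - y)) (L m y - L n y)
  linarith [hL m (x - y), hL n (x - y)]

/-- The derivative of `‖f‖²` is `2 Re ⟨f, f'⟩`. This is the energy estimate behind every contraction
bound below. -/
theorem norm_le_of_re_inner_deriv_nonpos {f f' : ℝ → E}
    (hf : ∀ t, 0 ≤ t → HasDerivWithinAt f (f' t) (Ici 0) t)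
    (h : ∀ t, 0 ≤ t → (⟪f t, f' t⟫_ℂ).re ≤ 0) {t : ℝ} (ht : 0 ≤ t) : ‖f t‖ ≤ ‖f 0‖ := by
  have hd : ∀ t, 0 ≤ t → HasDerivWithinAt (fun s => (⟪f s, f s⟫_ℂ).re)
      (⟪f t, f' t⟫_ℂ + ⟪f' t, f t⟫_ℂ).re (Ici 0) t := fun t ht =>
    Complex.reCLM.hasFDerivAt.comp_hasDerivWithinAt t ((hf t ht).inner ℂ (hf t ht))
  have ha : AntitoneOn (fun s => (⟪f s, f s⟫_ℂ).re) (Ici 0) := by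
    refine antitoneOn_of_hasDerivWithinAt_nonpos (convex_Ici 0)
      (fun t ht => (hd t ht).continuousWithinAt)
      (f' := fun t => (⟪f t, f' t⟫_ℂ + ⟪f' t, f t⟫_ℂ).re) (fun t ht => ?_) (fun t ht => ?_)
    · exact (hd t (interior_subset ht)).mono interior_subset
    · have h1 : (⟪f' t, f t⟫_ℂ).re = (⟪f t, f' t⟫_ℂ).re := inner_re_symm (𝕜 := ℂ) _ _
      rw [Complex.add_re, h1]
      linarith [h t (interior_subset ht)]
  have := ha (mem_Ici.mpr le_rfl) (mem_Ici.mpr ht) ht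
  have e : ∀ x : E, (⟪x, x⟫_ℂ).re = ‖x‖ ^ 2 := fun x => inner_self_eq_norm_sq (𝕜 := ℂ) x
  simp only [e] at this
  exact le_of_sq_le_sq this (norm_nonneg _)

variable {A : E →ₗ.[ℂ] E}

/-- Cauchy–Schwarz for `⟨U, μ U - A U⟩`, whose real part is at least `μ ‖U‖²`. For `μ > 0` this
gives injectivity of `μ - A` and the resolvent bound `1 / μ`. -/
theorem IsDissipative.mul_norm_le (hA : IsDissipative A) {μ : ℝ} (U : A.domain) :
    μ * ‖(U : E)‖ ≤ ‖(μ : ℂ) • (U : E) - A U‖ := by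
  by_cases h0 : (U : E) = 0
  · simp [h0]
  have hp : 0 < ‖(U : E)‖ := norm_pos_iff.mpr h0
  have h1 : (⟪(U : E), (μ : ℂ) • (U : E) - A U⟫_ℂ).re ≤ ‖(U : E)‖ * ‖(μ : ℂ) • (U : E) - A U‖ :=
    (Complex.re_le_norm _).trans (norm_inner_le_norm _ _)
  have e : (⟪(U : E), (U : E)⟫_ℂ) = ((‖(U : E)‖ ^ 2 : ℝ) : ℂ) := by
    rw [inner_self_eq_norm_sq_to_K]; push_cast; rfl
  rw [inner_sub_right, inner_smul_right, e, Complex.sub_re, ← Complex.ofReal_mul,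
    Complex.ofReal_re] at h1
  have h2 := hA U
  by_contra hc
  push Not at hc
  nlinarith

/-- The resolvent of an m-dissipative operator. -/
theorem IsMDissipative.exists_resolvent (hA : IsMDissipative A) {μ : ℝ} (hμ : 0 < μ) :
    ∃ R : E →L[ℂ] E, (∀ F, ∃ h : R F ∈ A.domain, (μ : ℂ) • R F - A ⟨R F, h⟩ = F) ∧
      (∀ U : A.domain, R ((μ : ℂ) • (U : E) - A U) = U) ∧ ∀ F, μ * ‖R F‖ ≤ ‖F‖ := by
  choose r hr using hA.2 μ hμ
  have inj : ∀ U V : A.domain, (μ : ℂ) • (U : E) - A U = (μ : ℂ) • (V : E) - A V → U = V := by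
    intro U V h
    have h1 := hA.1.mul_norm_le (μ := μ) (U - V)
    have e : (μ : ℂ) • ((U - V : A.domain) : E) - A (U - V) = 0 := by
      rw [LinearPMap.map_sub, Submodule.coe_sub, smul_sub, ← sub_eq_zero.mpr h]; abel
    rw [e, norm_zero] at h1
    have h2 : ‖((U - V : A.domain) : E)‖ = 0 := by
      have := norm_nonneg ((U - V : A.domain) : E)
      nlinarith
    exact sub_eq_zero.mp (Subtype.ext (norm_eq_zero.mp h2))
  let R : E →ₗ[ℂ] E :=
    { toFun F := r F
      map_add' F G := by
        rw [← Submodule.coe_add]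
        congr 1
        refine inj _ _ ?_
        rw [hr, LinearPMap.map_add, Submodule.coe_add, smul_add, add_sub_add_comm, hr, hr]
      map_smul' c F := by
        rw [RingHom.id_apply, ← Submodule.coe_smul]
        congr 1
        refine inj _ _ ?_
        rw [hr, LinearPMap.map_smul, Submodule.coe_smul, smul_comm, ← smul_sub, hr] }
  have hb : ∀ F, μ * ‖R F‖ ≤ ‖F‖ := fun F => by
    have := hA.1.mul_norm_le (μ := μ) (r F)
    rwa [hr] at this
  refine ⟨R.mkContinuous μ⁻¹ fun F => ?_, fun F => ⟨(r F).2, hr F⟩, fun U => ?_, hb⟩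
  · rw [inv_mul_eq_div, le_div_iff₀' hμ]
    exact hb F
  · change ((r _ : A.domain) : E) = U
    congr 1
    exact inj _ _ (hr _)

/-- If `F` is orthogonal to the domain and `U - A U = F`, pairing with `U` gives `‖U‖² = Re ⟨U, A U⟩
≤ 0`, so `F = 0`. Completeness is what makes a trivial orthogonal complement imply density. -/
theorem IsMDissipative.dense_domain [CompleteSpace E] (hA : IsMDissipative A) :
    Dense (A.domain : Set E) := by
  rw [Submodule.dense_iff_topologicalClosure_eq_top, Submodule.topologicalClosure_eq_top_iff,
    Submodule.eq_bot_iff]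
  intro F hF
  obtain ⟨U, hU⟩ := hA.2 1 one_pos F
  have h1 : ⟪(U : E), F⟫_ℂ = 0 := hF _ U.2
  have h2 := hA.1 U
  rw [← hU, inner_sub_right, sub_eq_zero] at h1
  rw [← h1, Complex.ofReal_one, one_smul] at h2
  have h3 : (⟪(U : E), (U : E)⟫_ℂ).re = ‖(U : E)‖ ^ 2 := inner_self_eq_norm_sq (𝕜 := ℂ) _
  rw [h3] at h2
  have h4 : (U : E) = 0 := norm_eq_zero.mp (by nlinarith [norm_nonneg (U : E)])
  have h5 : U = 0 := Subtype.ext h4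
  rw [← hU, h5]
  simp

theorem IsContractionSemigroup.norm_apply_le {T : ℝ≥0 → E →L[ℂ] E}
    (hT : IsContractionSemigroup T) (t : ℝ≥0) (x : E) : ‖T t x‖ ≤ ‖x‖ := by
  simpa using (T t).le_of_opNorm_le (hT.norm_le t) x

/-- If the generator of a contraction semigroup extends an m-dissipative operator, they agree. -/
theorem IsMDissipative.isGenerator (hA : IsMDissipative A) {T : ℝ≥0 → E →L[ℂ] E}
    (hT : IsContractionSemigroup T)
    (h : ∀ U : A.domain,
      Tendsto (fun t : ℝ≥0 => ((t : ℝ)⁻¹ : ℂ) • (T t (U : E) - U)) (𝓝[>] 0) (𝓝 (A U))) :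
    IsGenerator A T := by
  intro U F
  constructor
  · intro hUF
    obtain ⟨V, hV, hV'⟩ := (LinearPMap.mem_graph_iff A).mp hUF
    simp only at hV hV'
    rw [← hV, ← hV']
    exact h V
  · intro hUF
    -- With this `V`, the vector `y = U - V` satisfies `G y = y` for the generator `G`.
    -- Contractivity gives `Re ⟨y, T(t) y - y⟩ ≤ 0`, which forces `‖y‖² ≤ 0`.
    obtain ⟨V, hV⟩ := hA.2 1 one_pos (U - F)
    rw [Complex.ofReal_one, one_smul] at hV
    have hy : F - A V = U - V := by
      rw [sub_eq_sub_iff_add_eq_add] at hV ⊢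
      rw [add_comm F, hV, add_comm]
    have h1 := hUF.sub (h V)
    rw [hy] at h1
    have h2 : Tendsto (fun t : ℝ≥0 => ((t : ℝ)⁻¹ : ℂ) • (T t (U - V) - (U - V))) (𝓝[>] 0)
        (𝓝 (U - V)) := by
      refine h1.congr fun t => ?_
      rw [← smul_sub, map_sub]
      congr 1
      abel
    set y := U - (V : E)
    have h3 : Tendsto (fun t : ℝ≥0 => (⟪y, ((t : ℝ)⁻¹ : ℂ) • (T t y - y)⟫_ℂ).re) (𝓝[>] 0)
        (𝓝 (⟪y, y⟫_ℂ).re) :=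
      (Complex.continuous_re.tendsto _).comp ((tendsto_const_nhds (x := y)).inner h2)
    have e : ∀ x : E, (⟪x, x⟫_ℂ).re = ‖x‖ ^ 2 := fun x => inner_self_eq_norm_sq (𝕜 := ℂ) x
    have h4 : (⟪y, y⟫_ℂ).re ≤ 0 := by
      refine le_of_tendsto' h3 fun t => ?_
      rw [inner_smul_right, ← Complex.ofReal_inv, Complex.re_ofReal_mul, inner_sub_right,
        Complex.sub_re, e]
      have h5 : (⟪y, T t y⟫_ℂ).re ≤ ‖y‖ * ‖T t y‖ :=
        (Complex.re_le_norm _).trans (norm_inner_le_norm _ _)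
      have h6 := hT.norm_apply_le t y
      refine mul_nonpos_of_nonneg_of_nonpos (by positivity) ?_
      nlinarith [norm_nonneg y]
    rw [e] at h4
    have h5 : y = 0 := norm_eq_zero.mp (by nlinarith [norm_nonneg y])
    have hUV : (V : E) = U := (sub_eq_zero.mp h5).symm
    refine (LinearPMap.mem_graph_iff A).mpr ⟨V, hUV, ?_⟩
    rw [h5] at hy
    exact (sub_eq_zero.mp hy).symm

/-- Orbits starting in the domain of the generator are differentiable. -/
theorem IsGenerator.orbit {T : ℝ≥0 → E →L[ℂ] E} (hG : IsGenerator A T)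
    (hT : IsContractionSemigroup T) (U : A.domain) (t : ℝ≥0) :
    ∃ h : T t (U : E) ∈ A.domain, A ⟨T t (U : E), h⟩ = T t (A U) := by
  have h1 := (hG U (A U)).mp (A.mem_graph U)
  have h2 : (T t (U : E), T t (A U)) ∈ A.graph := by
    rw [hG]
    refine (((T t).continuous.tendsto _).comp h1).congr fun s => ?_
    simp only [Function.comp_apply]
    rw [map_smul, map_sub]
    congr 2
    have e1 : T t (T s (U : E)) = T (t + s) (U : E) := by rw [hT.add]; rfl
    have e2 : T s (T t (U : E)) = T (s + t) (U : E) := by rw [hT.add]; rfl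
    rw [e1, e2, add_comm]
  obtain ⟨V, hV, hV'⟩ := (LinearPMap.mem_graph_iff A).mp h2
  simp only at hV hV'
  have hm : T t (U : E) ∈ A.domain := hV ▸ V.2
  refine ⟨hm, ?_⟩
  rw [← hV']
  congr 1
  exact Subtype.ext hV.symm

theorem IsContractionSemigroup.continuous_toNNReal {T : ℝ≥0 → E →L[ℂ] E}
    (hT : IsContractionSemigroup T) (x : E) : Continuous fun t : ℝ => T t.toNNReal x :=
  (hT.continuous x).comp continuous_real_toNNReal

/-- The definition of the generator gives only a right derivative at `0`. By the semigroup law the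
slope between `s` and `t`, on either side, is `T(min s t)` applied to the quotient `q` at `|s - t|`;
contractivity and strong continuity then pass to the limit. -/
theorem IsGenerator.hasDerivWithinAt {T : ℝ≥0 → E →L[ℂ] E} (hG : IsGenerator A T)
    (hT : IsContractionSemigroup T) (U : A.domain) {t : ℝ} (ht : 0 ≤ t) :
    HasDerivWithinAt (fun s : ℝ => T s.toNNReal (U : E)) (T t.toNNReal (A U)) (Ici 0) t := by
  rw [hasDerivWithinAt_iff_tendsto_slope]
  have h1 := (hG U (A U)).mp (A.mem_graph U)
  let q : ℝ≥0 → E := fun t => ((t : ℝ)⁻¹ : ℂ) • (T t (U : E) - U)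
  let m : ℝ → ℝ≥0 := fun s => min s.toNNReal t.toNNReal
  let d : ℝ → ℝ≥0 := fun s => |s - t|.toNNReal
  have hm : Continuous m := by fun_prop
  have hd : Continuous d := by fun_prop
  have hd0 : Tendsto d (𝓝[Ici 0 \ {t}] t) (𝓝[>] 0) := by
    refine tendsto_nhdsWithin_iff.mpr ⟨?_, ?_⟩
    · have := hd.tendsto t
      simp only [d, sub_self, abs_zero, Real.toNNReal_zero] at this
      exact this.mono_left nhdsWithin_le_nhds
    · filter_upwards [self_mem_nhdsWithin] with s hs
      simpa [d, sub_eq_zero] using hs.2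
  have hq := h1.comp hd0
  have hmT : Tendsto (fun s => T (m s) (A U)) (𝓝[Ici 0 \ {t}] t) (𝓝 (T t.toNNReal (A U))) := by
    have : Continuous fun s => T (m s) (A U) := (hT.continuous (A U)).comp hm
    have := this.tendsto t
    simp only [m, min_self] at this
    exact this.mono_left nhdsWithin_le_nhds
  have key : Tendsto (fun s => T (m s) (q (d s) - A U)) (𝓝[Ici 0 \ {t}] t) (𝓝 0) := by
    refine squeeze_zero_norm (fun s => hT.norm_apply_le _ _) ?_
    have := (hq.sub_const (A U)).norm
    simpa using this
  have := key.add hmT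
  rw [zero_add] at this
  refine this.congr' ?_
  filter_upwards [self_mem_nhdsWithin] with s hs
  have hs0 : 0 ≤ s := hs.1
  rw [← map_add, sub_add_cancel, slope_def_module]
  simp only [q, map_smul, map_sub]
  have e : ∀ a b : ℝ≥0, T a (T b (U : E)) = T (a + b) (U : E) := fun a b => by rw [hT.add]; rfl
  rw [e]
  rcases le_total s t with h | h
  · have e1 : m s = s.toNNReal := min_eq_left (Real.toNNReal_le_toNNReal h)
    have e3 : ((d s : ℝ≥0) : ℝ) = -(s - t) := by
      simp only [d]
      rw [abs_of_nonpos (by linarith), Real.coe_toNNReal _ (by linarith)]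
    have e2 : s.toNNReal + d s = t.toNNReal := NNReal.eq (by
      rw [NNReal.coe_add, e3, Real.coe_toNNReal _ hs0, Real.coe_toNNReal _ ht]; ring)
    rw [e1, e2, e3, ← Complex.ofReal_inv, Complex.coe_smul, inv_neg, neg_smul, ← smul_neg, neg_sub]
  · have e1 : m s = t.toNNReal := min_eq_right (Real.toNNReal_le_toNNReal h)
    have e3 : ((d s : ℝ≥0) : ℝ) = s - t := by
      simp only [d]
      rw [abs_of_nonneg (by linarith), Real.coe_toNNReal _ (by linarith)]
    have e2 : t.toNNReal + d s = s.toNNReal := NNReal.eq (by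
      rw [NNReal.coe_add, e3, Real.coe_toNNReal _ hs0, Real.coe_toNNReal _ ht]; ring)
    rw [e1, e2, e3, ← Complex.ofReal_inv, Complex.coe_smul]

theorem IsGenerator.isStrongSolution {T : ℝ≥0 → E →L[ℂ] E} (hG : IsGenerator A T)
    (hT : IsContractionSemigroup T) (U : A.domain) :
    IsStrongSolution A U fun t : ℝ => T t.toNNReal (U : E) where
  init := by simp [hT.zero]
  mem t _ := (hG.orbit hT U t.toNNReal).1
  cont := (hT.continuous_toNNReal _).continuousOn
  cont_A := by
    refine ((hT.continuous_toNNReal (A U)).comp continuous_subtype_val).congr fun t => ?_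
    exact (hG.orbit hT U _).2.symm
  deriv t ht := by
    rw [(hG.orbit hT U _).2]
    exact hG.hasDerivWithinAt hT U ht

/-- The integrated identity `⟨W, T(s)U⟩ - ⟨W, U⟩ = ∫₀ˢ ⟨Z, T(r)U⟩ dr` holds on the domain by the
fundamental theorem of calculus. Both sides are Lipschitz in `U`, so it extends by density, and its
right side is differentiable in `s`. -/
theorem IsGenerator.isWeakSolution {T : ℝ≥0 → E →L[ℂ] E} (hG : IsGenerator A T)
    (hT : IsContractionSemigroup T) (hd : Dense (A.domain : Set E)) (U : E) :
    IsWeakSolution A U fun t : ℝ => T t.toNNReal U where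
  init := by simp [hT.zero]
  cont := (hT.continuous_toNNReal _).continuousOn
  weak W Z hWZ t ht := by
    have hc : ∀ (Y x : E), Continuous fun s : ℝ => ⟪Y, T s.toNNReal x⟫_ℂ := fun Y x =>
      continuous_const.inner (hT.continuous_toNNReal x)
    have hb : ∀ (Y x : E) (s : ℝ), ‖⟪Y, T s.toNNReal x⟫_ℂ‖ ≤ ‖Y‖ * ‖x‖ := fun Y x s =>
      (norm_inner_le_norm _ _).trans
        (mul_le_mul_of_nonneg_left (hT.norm_apply_le _ _) (norm_nonneg _))
    have key : ∀ s : ℝ, 0 ≤ s → ⟪W, T s.toNNReal U⟫_ℂ - ⟪W, U⟫_ℂ -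
        ∫ r in (0 : ℝ)..s, ⟪Z, T r.toNNReal U⟫_ℂ = 0 := by
      intro s hs
      have hdom : ∀ V : A.domain, ⟪W, T s.toNNReal (V : E)⟫_ℂ - ⟪W, (V : E)⟫_ℂ -
          ∫ r in (0 : ℝ)..s, ⟪Z, T r.toNNReal (V : E)⟫_ℂ = 0 := by
        intro V
        have := intervalIntegral.integral_eq_sub_of_hasDeriv_right_of_le hs
          (f := fun r => ⟪W, T r.toNNReal (V : E)⟫_ℂ)
          (f' := fun r => ⟪Z, T r.toNNReal (V : E)⟫_ℂ)
          (hc W V).continuousOn (fun r hr => ?_) ((hc Z V).intervalIntegrable _ _)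
        · rw [this]
          simp [hT.zero]
        · have h1 := (hG.hasDerivWithinAt hT V hr.1.le).mono
            (Ioi_subset_Ici hr.1.le)
          have h2 := (hasDerivWithinAt_const r (Ioi r) W).inner ℂ h1
          rw [inner_zero_left, add_zero] at h2
          obtain ⟨hm, he⟩ := hG.orbit hT V r.toNNReal
          have h3 := hWZ ⟨_, hm⟩
          rw [he] at h3
          rwa [h3] at h2
      let Φ : E → ℂ := fun x => ⟪W, T s.toNNReal x⟫_ℂ - ⟪W, x⟫_ℂ -
          ∫ r in (0 : ℝ)..s, ⟪Z, T r.toNNReal x⟫_ℂ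
      have hΦ : ∀ x y, ‖Φ x - Φ y‖ ≤ (2 * ‖W‖ + s * ‖Z‖) * ‖x - y‖ := by
        intro x y
        have e : Φ x - Φ y = ⟪W, T s.toNNReal (x - y)⟫_ℂ - ⟪W, x - y⟫_ℂ -
            ∫ r in (0 : ℝ)..s, ⟪Z, T r.toNNReal (x - y)⟫_ℂ := by
          simp only [Φ, map_sub, inner_sub_right]
          rw [intervalIntegral.integral_sub ((hc Z x).intervalIntegrable _ _)
            ((hc Z y).intervalIntegrable _ _)]
          ring
        rw [e]
        have h1 := intervalIntegral.norm_integral_le_of_norm_le_const (a := 0) (b := s)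
          (f := fun r : ℝ => ⟪Z, T r.toNNReal (x - y)⟫_ℂ) (fun r _ => hb Z (x - y) r)
        rw [sub_zero, abs_of_nonneg hs] at h1
        have h2 := norm_sub_le (⟪W, T s.toNNReal (x - y)⟫_ℂ - ⟪W, x - y⟫_ℂ)
          (∫ r in (0 : ℝ)..s, ⟪Z, T r.toNNReal (x - y)⟫_ℂ)
        have h3 := norm_sub_le ⟪W, T s.toNNReal (x - y)⟫_ℂ ⟪W, x - y⟫_ℂ
        have h4 := hb W (x - y) s
        have h5 := norm_inner_le_norm (𝕜 := ℂ) W (x - y)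
        linarith
      have hΦc : Continuous Φ := by
        refine (LipschitzWith.of_dist_le_mul (K := (2 * ‖W‖ + s * ‖Z‖).toNNReal)
          fun x y => ?_).continuous
        rw [dist_eq_norm, dist_eq_norm, Real.coe_toNNReal _ (by positivity)]
        exact hΦ x y
      exact congrFun (hΦc.ext_on hd (continuous_const (y := (0 : ℂ)))
        fun V hV => hdom ⟨V, hV⟩) U
    have hF : HasDerivAt (fun s => ⟪W, U⟫_ℂ + ∫ r in (0 : ℝ)..s, ⟪Z, T r.toNNReal U⟫_ℂ)
        ⟪Z, T t.toNNReal U⟫_ℂ t :=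
      (((hc Z U).integral_hasStrictDerivAt 0 t).hasDerivAt).const_add _
    refine hF.hasDerivWithinAt.congr (fun s hs => ?_) ?_
    · linear_combination key s hs
    · linear_combination key t ht

theorem IsStrongSolution.isWeakSolution {U₀ : E} {U : ℝ → E} (h : IsStrongSolution A U₀ U) :
    IsWeakSolution A U₀ U where
  init := h.init
  cont := h.cont
  weak W Z hWZ t ht := by
    have h2 := (hasDerivWithinAt_const t (Ici 0) W).inner ℂ (h.deriv t ht)
    rwa [inner_zero_left, add_zero, hWZ ⟨U t, h.mem t ht⟩] at h2

/-- Weak solutions are unique if the adjoint of `A` extends a conjugate of `A`. -/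
theorem IsGenerator.weakSolution_unique {T : ℝ≥0 → E →L[ℂ] E} (hG : IsGenerator A T)
    (hT : IsContractionSemigroup T) (hd : Dense (A.domain : Set E)) (J : E ≃ₗᵢ[ℂ] E)
    (hJ : ∀ U : A.domain, IsAdjointPair A (J U) (J (A U))) {U₀ : E} {U W : ℝ → E}
    (hU : IsWeakSolution A U₀ U) (hW : IsWeakSolution A U₀ W) : EqOn W U (Ici 0) := by
  intro τ hτ
  let Y : ℝ → E := fun s => W s - U s
  have hYc : ContinuousOn Y (Ici 0) := hW.cont.sub hU.cont
  have hY0 : Y 0 = 0 := by simp [Y, hW.init, hU.init]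
  have hY : ∀ P Q : E, IsAdjointPair A P Q → ∀ t : ℝ, 0 ≤ t →
      HasDerivWithinAt (fun s => ⟪P, Y s⟫_ℂ) ⟪Q, Y t⟫_ℂ (Ici 0) t := by
    intro P Q hPQ t ht
    simp only [Y, inner_sub_right]
    exact (hW.weak P Q hPQ t ht).sub (hU.weak P Q hPQ t ht)
  have main : ∀ V : A.domain, ⟪J (V : E), Y τ⟫_ℂ = 0 := by
    intro V
    -- A backward solution of the adjoint equation: `P' = -A* P`, with `Q = A* P` and `P τ = J V`.
    -- The pairing `⟨P s, Y s⟩` will be constant and vanish at `s = 0`.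
    let P : ℝ → E := fun s => J (T (τ - s).toNNReal (V : E))
    let Q : ℝ → E := fun s => J (T (τ - s).toNNReal (A V))
    have hP : ∀ s ∈ Icc 0 τ, HasDerivWithinAt P (-Q s) (Icc 0 τ) s := by
      intro s hs
      have h1 := hG.hasDerivWithinAt hT V (t := τ - s) (by linarith [hs.2])
      have h2 : HasDerivWithinAt (fun s => τ - s) (-1 : ℝ) (Icc 0 τ) s :=
        ((hasDerivAt_id s).const_sub τ).hasDerivWithinAt
      have h3 := h1.scomp s h2 (fun r hr => by simpa using hr.2)
      have h4 := (J.toContinuousLinearEquiv.toContinuousLinearMap.restrictScalars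
        ℝ).hasFDerivAt.comp_hasDerivWithinAt s h3
      refine h4.congr_deriv ?_
      simp [Q]
    have hPQ : ∀ s, IsAdjointPair A (P s) (Q s) := by
      intro s
      obtain ⟨hm, he⟩ := hG.orbit hT V (τ - s).toNNReal
      have := hJ ⟨_, hm⟩
      rwa [he] at this
    -- `Y` is differentiable only against fixed elements of the domain of `A*`, so no product rule
    -- applies. The slope splits into that of `⟨P s, Y ·⟩` with `P s` frozen and the slope of `P`
    -- paired with `Y r`, where norm continuity of `Y` suffices.
    have hder : ∀ s ∈ Icc 0 τ,
        HasDerivWithinAt (fun s => ⟪P s, Y s⟫_ℂ) 0 (Icc 0 τ) s := by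
      intro s hs
      have h1 := hasDerivWithinAt_iff_tendsto_slope.mp
        ((hY _ _ (hPQ s) s hs.1).mono (Icc_subset_Ici_self : Icc 0 τ ⊆ Ici 0))
      have h2 := hasDerivWithinAt_iff_tendsto_slope.mp (hP s hs)
      have h3 : Tendsto Y (𝓝[Icc 0 τ \ {s}] s) (𝓝 (Y s)) :=
        (hYc s hs.1).mono_left (nhdsWithin_mono _ (sdiff_subset.trans Icc_subset_Ici_self))
      rw [hasDerivWithinAt_iff_tendsto_slope]
      have h4 := h1.add (h2.inner h3)
      rw [inner_neg_left, add_neg_cancel] at h4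
      refine h4.congr fun r => ?_
      simp only [slope_def_module, ← Complex.coe_smul (r - s)⁻¹, inner_smul_left,
        inner_sub_left, smul_eq_mul, Complex.conj_ofReal]
      ring
    have hconst := constant_of_derivWithin_zero (a := 0) (b := τ)
      (f := fun s => ⟪P s, Y s⟫_ℂ) (fun s hs => (hder s hs).differentiableWithinAt)
      (fun s hs => (hder s ⟨hs.1, hs.2.le⟩).derivWithin
        (uniqueDiffOn_Icc (hs.1.trans_lt hs.2) s ⟨hs.1, hs.2.le⟩)) τ ⟨hτ, le_rfl⟩
    simpa [P, hT.zero, hY0] using hconst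
  have h0 : J.symm (Y τ) = 0 := by
    refine hd.eq_zero_of_inner_left ℂ fun V hV => ?_
    rw [← J.inner_map_map, J.apply_symm_apply, ← inner_conj_symm, main ⟨V, hV⟩, map_zero]
  have : Y τ = 0 := by simpa using h0
  exact sub_eq_zero.mp this

end Semigroup

/-! ### The Hille–Yosida theorem by Yosida approximation. -/

section HilleYosida

variable {E : Type*} [NormedAddCommGroup E] [InnerProductSpace ℂ E] [CompleteSpace E]
  {A : E →ₗ.[ℂ] E}

/-- The Yosida approximations of an m-dissipative operator. -/
theorem IsMDissipative.exists_yosida (hA : IsMDissipative A) :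
    ∃ Y : ℕ → E →L[ℂ] E, (∀ n x, (⟪x, Y n x⟫_ℂ).re ≤ 0) ∧ (∀ n m, Commute (Y n) (Y m)) ∧
      ∀ U : A.domain, Tendsto (fun n => Y n U) atTop (𝓝 (A U)) := by
  have hpos : ∀ n : ℕ, (0 : ℝ) < n + 1 := fun n => by positivity
  choose R hR1 hR2 hR3 using fun n : ℕ => hA.exists_resolvent (hpos n)
  let c : ℕ → ℂ := fun n => ((n + 1 : ℝ) : ℂ)
  -- The resolvent identity at the points `c n = n + 1`. Adding it to the version with `n` and `m`
  -- exchanged shows that the resolvents commute.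
  have hres : ∀ n m F, R n F + (c n - c m) • R n (R m F) = R m F := by
    intro n m F
    obtain ⟨h, hF⟩ := hR1 m F
    have h1 := hR2 n ⟨R m F, h⟩
    have e : c n • R m F - A ⟨R m F, h⟩ = F + (c n - c m) • R m F := by
      have hF' : F = c m • R m F - A ⟨R m F, h⟩ := hF.symm
      rw [sub_smul]
      generalize A ⟨R m F, h⟩ = z at hF' ⊢
      rw [← sub_eq_zero] at hF' ⊢
      rw [← neg_eq_zero, ← hF']
      abel
    simp only [c] at e ⊢
    rw [e, map_add, map_smul] at h1
    exact h1
  have hcomm : ∀ n m, Commute (R n) (R m) := by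
    intro n m
    rcases eq_or_ne n m with rfl | hnm
    · exact Commute.refl _
    refine ContinuousLinearMap.ext fun F => ?_
    have hc : c n - c m ≠ 0 := by
      rw [sub_ne_zero]
      simpa [c] using hnm
    have h1 := hres n m F
    have h2 := hres m n F
    have h3 : (c n - c m) • R n (R m F) = (c n - c m) • R m (R n F) := by
      rw [← neg_sub (c n), neg_smul, ← sub_eq_add_neg, sub_eq_iff_eq_add] at h2
      exact add_left_cancel (h1.trans h2)
    exact smul_right_injective E hc h3
  let P : ℕ → E →L[ℂ] E := fun n => c n • R n
  have hP : ∀ n x, ‖P n x‖ ≤ ‖x‖ := fun n x => by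
    have := hR3 n x
    simp only [P, c, _root_.smul_apply, norm_smul, Complex.norm_real,
      Real.norm_of_nonneg (hpos n).le]
    exact this
  have hPA : ∀ n (U : A.domain), P n (U : E) - U = R n (A U) := fun n U => by
    have := hR2 n U
    rw [map_sub, map_smul] at this
    nth_rewrite 2 [← this]
    simp [P, c]
  -- On the domain `P n U - U = R n (A U)` has norm at most `‖A U‖ / (n + 1)`; elsewhere the
  -- contractions `P n` converge by density.
  have hPlim : ∀ x, Tendsto (fun n => P n x) atTop (𝓝 x) := by
    refine tendsto_of_dense_of_norm_le (M := ContinuousLinearMap.id ℂ E) hA.dense_domain hP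
      (fun x => le_rfl) fun x hx => ?_
    rw [ContinuousLinearMap.id_apply, tendsto_iff_norm_sub_tendsto_zero]
    refine squeeze_zero (fun n => norm_nonneg _) (fun n => ?_)
      (g := fun n : ℕ => 1 / ((n : ℝ) + 1) * ‖A ⟨x, hx⟩‖)
      (by simpa using tendsto_one_div_add_atTop_nhds_zero_nat.mul_const ‖A ⟨x, hx⟩‖)
    rw [hPA n ⟨x, hx⟩, one_div, inv_mul_eq_div, le_div_iff₀' (hpos n)]
    exact hR3 n _
  -- On the domain `c n • (P n - 1)` agrees with `P n ∘ A`, hence tends to `A`. It is dissipative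
  -- because `P n` is a contraction.
  refine ⟨fun n => c n • (P n - 1), fun n x => ?_, fun n m => ?_, fun U => ?_⟩
  · have e : (⟪x, x⟫_ℂ).re = ‖x‖ ^ 2 := inner_self_eq_norm_sq (𝕜 := ℂ) x
    have h1 : (⟪x, P n x⟫_ℂ).re ≤ ‖x‖ * ‖P n x‖ :=
      (Complex.re_le_norm _).trans (norm_inner_le_norm _ _)
    rw [_root_.smul_apply, inner_smul_right, Complex.re_ofReal_mul,
      _root_.sub_apply, inner_sub_right, Complex.sub_re,
      one_apply_eq_self, e]
    refine mul_nonpos_of_nonneg_of_nonpos (hpos n).le ?_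
    nlinarith [hP n x, norm_nonneg x]
  · have h1 : Commute (P n) (P m) := ((hcomm n m).smul_left _).smul_right _
    exact (((h1.sub_left (Commute.one_left _)).sub_right
      (Commute.one_right _)).smul_left _).smul_right _
  · refine (hPlim (A U)).congr fun n => ?_
    have := hPA n U
    simp [P, ← this]

theorem hasDerivAt_exp_smul_apply (Y : E →L[ℂ] E) (x : E) (t : ℝ) :
    HasDerivAt (fun s : ℝ => NormedSpace.exp (s • Y) x) (NormedSpace.exp (t • Y) (Y x)) t :=
  ((ContinuousLinearMap.apply ℂ E x).restrictScalars ℝ).hasFDerivAt.comp_hasDerivAt t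
    (hasDerivAt_exp_smul_const Y t)

theorem hasDerivAt_exp_smul_apply' (Y : E →L[ℂ] E) (x : E) (t : ℝ) :
    HasDerivAt (fun s : ℝ => NormedSpace.exp (s • Y) x) (Y (NormedSpace.exp (t • Y) x)) t :=
  ((ContinuousLinearMap.apply ℂ E x).restrictScalars ℝ).hasFDerivAt.comp_hasDerivAt t
    (hasDerivAt_exp_smul_const' Y t)

theorem norm_exp_smul_apply_le {Y : E →L[ℂ] E} (hY : ∀ x, (⟪x, Y x⟫_ℂ).re ≤ 0) {t : ℝ}
    (ht : 0 ≤ t) (x : E) : ‖NormedSpace.exp (t • Y) x‖ ≤ ‖x‖ := by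
  have := norm_le_of_re_inner_deriv_nonpos
    (f := fun t : ℝ => NormedSpace.exp (t • Y) x)
    (fun t _ => (hasDerivAt_exp_smul_apply' Y x t).hasDerivWithinAt) (fun t _ => hY _) ht
  simpa using this

/-- Commutation allows interpolation by `s ↦ exp((t - s) Z) exp(s Y) x` on `[0, t]`, whose
derivative is two contractions applied to `Y x - Z x`. -/
theorem norm_exp_smul_sub_le {Y Z : E →L[ℂ] E} (hY : ∀ x, (⟪x, Y x⟫_ℂ).re ≤ 0)
    (hZ : ∀ x, (⟪x, Z x⟫_ℂ).re ≤ 0) (hYZ : Commute Y Z) {t : ℝ} (ht : 0 ≤ t) (x : E) :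
    ‖NormedSpace.exp (t • Y) x - NormedSpace.exp (t • Z) x‖ ≤ ‖Y x - Z x‖ * t := by
  let f : ℝ → E := fun s =>
    NormedSpace.exp (t • Z) (NormedSpace.exp (s • (Y - Z)) x)
  have he : ∀ s : ℝ, NormedSpace.exp (t • Z) * NormedSpace.exp (s • (Y - Z)) =
      NormedSpace.exp ((t - s) • Z) * NormedSpace.exp (s • Y) := by
    intro s
    have hc : Commute (Y - Z) Z := hYZ.sub_left (Commute.refl Z)
    let _ : NormedAlgebra ℚ (E →L[ℂ] E) := NormedAlgebra.restrictScalars ℚ ℂ _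
    rw [← NormedSpace.exp_add_of_commute ((hc.symm.smul_left _).smul_right _),
      ← NormedSpace.exp_add_of_commute ((hYZ.symm.smul_left _).smul_right _)]
    congr 1
    module
  have hf : ∀ s : ℝ, HasDerivAt f
      (NormedSpace.exp ((t - s) • Z) (NormedSpace.exp (s • Y) (Y x - Z x))) s := by
    intro s
    have h1 := ((NormedSpace.exp (t • Z)).restrictScalars ℝ).hasFDerivAt.comp_hasDerivAt s
      (hasDerivAt_exp_smul_apply (Y - Z) x s)
    refine h1.congr_deriv ?_
    exact congrArg (fun L : E →L[ℂ] E => L (Y x - Z x)) (he s)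
  have := norm_image_sub_le_of_norm_deriv_le_segment' (a := 0) (b := t)
    (fun s _ => (hf s).hasDerivWithinAt) (C := ‖Y x - Z x‖) (fun s hs =>
      (norm_exp_smul_apply_le hZ (by linarith [hs.2]) _).trans
        (norm_exp_smul_apply_le hY hs.1 _)) t ⟨ht, le_rfl⟩
  have e1 : f t = NormedSpace.exp (t • Y) x := by
    have := congrArg (fun L : E →L[ℂ] E => L x) (he t)
    simpa using this
  have e2 : f 0 = NormedSpace.exp (t • Z) x := by simp [f]
  rwa [e1, e2, sub_zero] at this

/-- The Hille–Yosida (Lumer–Phillips) theorem in Hilbert spaces. -/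
theorem IsMDissipative.exists_semigroup (hA : IsMDissipative A) :
    ∃ T : ℝ≥0 → E →L[ℂ] E, IsContractionSemigroup T ∧ IsGenerator A T := by
  obtain ⟨Y, hY, hcomm, hlim⟩ := hA.exists_yosida
  let S : ℕ → ℝ≥0 → E →L[ℂ] E := fun n t => NormedSpace.exp ((t : ℝ) • Y n)
  have hS : ∀ n t x, ‖S n t x‖ ≤ ‖x‖ := fun n t x => norm_exp_smul_apply_le (hY n) t.2 x
  have hcauchy : ∀ t x, CauchySeq fun n => S n t x := by
    intro t
    refine cauchySeq_of_dense_of_norm_le hA.dense_domain (fun n x => hS n t x) fun x hx => ?_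
    rw [Metric.cauchySeq_iff]
    intro ε hε
    -- The factor `t + 1` instead of `t` covers `t = 0`.
    obtain ⟨N, hN⟩ := Metric.cauchySeq_iff.mp (hlim ⟨x, hx⟩).cauchySeq (ε / (t + 1))
      (by positivity)
    refine ⟨N, fun m hm n hn => ?_⟩
    have h1 := hN m hm n hn
    rw [dist_eq_norm, lt_div_iff₀ (by positivity)] at h1
    rw [dist_eq_norm]
    refine (norm_exp_smul_sub_le (hY m) (hY n) (hcomm m n) t.2 x).trans_lt
      (lt_of_le_of_lt ?_ h1)
    exact mul_le_mul_of_nonneg_left (by simp) (norm_nonneg _)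
  choose T₀ hT₀ using fun t x => cauchySeq_tendsto_of_complete (hcauchy t x)
  let T : ℝ≥0 → E →L[ℂ] E := fun t =>
    continuousLinearMapOfTendsto (S · t) (tendsto_pi_nhds.mpr (hT₀ t))
  have hT : ∀ t x, Tendsto (fun n => S n t x) atTop (𝓝 (T t x)) := hT₀
  have hTn : ∀ t x, ‖T t x‖ ≤ ‖x‖ := fun t x => le_of_tendsto' (hT t x).norm fun n => hS n t x
  have hcont_dom : ∀ U : A.domain, Continuous fun t => T t (U : E) := by
    intro U
    refine (LipschitzWith.of_dist_le_mul (K := ‖A U‖₊) fun t s => ?_).continuous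
    wlog hst : s ≤ t generalizing s t
    · rw [dist_comm, dist_comm t]
      exact this _ _ (le_of_not_ge hst)
    rw [dist_eq_norm, NNReal.dist_eq, abs_of_nonneg (sub_nonneg.mpr (by exact_mod_cast hst))]
    refine le_of_tendsto_of_tendsto' ((hT t U).sub (hT s U)).norm
      ((hlim U).norm.mul_const ((t : ℝ) - s)) fun n => ?_
    exact norm_image_sub_le_of_norm_deriv_le_segment' (a := s) (b := t)
      (f := fun r : ℝ => NormedSpace.exp (r • Y n) (U : E))
      (fun r _ => (hasDerivAt_exp_smul_apply (Y n) U r).hasDerivWithinAt) (C := ‖Y n U‖)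
      (fun r hr => norm_exp_smul_apply_le (hY n) (s.2.trans hr.1) _) t
      ⟨by exact_mod_cast hst, le_rfl⟩
  have hsg : IsContractionSemigroup T := by
    refine ⟨?_, fun s t => ?_, fun t => ?_, fun x => ?_⟩
    · refine ContinuousLinearMap.ext fun x => tendsto_nhds_unique (hT 0 x) ?_
      simp [S]
    · refine ContinuousLinearMap.ext fun x => tendsto_nhds_unique (hT (s + t) x) ?_
      rw [ContinuousLinearMap.comp_apply]
      have h1 : Tendsto (fun n => S n s (S n t x - T t x)) atTop (𝓝 0) := by
        refine squeeze_zero_norm (fun n => hS n s _) ?_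
        simpa using ((hT t x).sub_const (T t x)).norm
      have h2 := h1.add (hT s (T t x))
      rw [zero_add] at h2
      refine h2.congr fun n => ?_
      rw [← map_add, sub_add_cancel]
      simp only [S]
      let _ : NormedAlgebra ℚ (E →L[ℂ] E) := NormedAlgebra.restrictScalars ℚ ℂ _
      rw [NNReal.coe_add, add_smul, NormedSpace.exp_add_of_commute
        (((Commute.refl (Y n)).smul_left _).smul_right _)]
      rfl
    · exact ContinuousLinearMap.opNorm_le_bound _ zero_le_one fun x => by simpa using hTn t x
    · rw [continuous_iff_continuousAt]
      intro t
      exact tendsto_of_dense_of_norm_le hA.dense_domain hTn (hTn t)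
        (fun x hx => (hcont_dom ⟨x, hx⟩).tendsto t) x
  refine ⟨T, hsg, hA.isGenerator hsg fun U => ?_⟩
  -- The integrated equation for the approximations passes to the limit by dominated convergence,
  -- the norms `‖Y n U‖` being bounded. Differentiating at `t = 0` then identifies the generator on
  -- the domain of `A`.
  have hint : ∀ t : ℝ≥0, T t (U : E) - U = ∫ s in (0 : ℝ)..t, T s.toNNReal (A U) := by
    intro t
    obtain ⟨C, hC⟩ := (hlim U).norm.bddAbove_range
    have h1 : Tendsto (fun n => ∫ s in (0 : ℝ)..t, S n s.toNNReal (Y n U)) atTop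
        (𝓝 (∫ s in (0 : ℝ)..t, T s.toNNReal (A U))) := by
      refine intervalIntegral.tendsto_integral_filter_of_dominated_convergence (fun _ => C)
        (Eventually.of_forall fun n => ?_)
        (Eventually.of_forall fun n => Eventually.of_forall fun s _ =>
          (hS n _ _).trans (hC ⟨n, rfl⟩)) intervalIntegrable_const
        (Eventually.of_forall fun s _ => ?_)
      · refine Continuous.aestronglyMeasurable ?_
        have : Continuous fun r : ℝ => NormedSpace.exp (r • Y n) (Y n U) :=
          continuous_iff_continuousAt.mpr fun r =>
            (hasDerivAt_exp_smul_apply (Y n) _ r).continuousAt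
        exact this.comp (NNReal.continuous_coe.comp continuous_real_toNNReal)
      · have h2 : Tendsto (fun n => S n s.toNNReal (Y n U - A U)) atTop (𝓝 0) := by
          refine squeeze_zero_norm (fun n => hS n _ _) ?_
          simpa using ((hlim U).sub_const (A U)).norm
        have h3 := h2.add (hT s.toNNReal (A U))
        rw [zero_add] at h3
        exact h3.congr fun n => by rw [← map_add, sub_add_cancel]
    refine tendsto_nhds_unique ((hT t U).sub_const (U : E)) (h1.congr fun n => ?_)
    have h2 := intervalIntegral.integral_eq_sub_of_hasDerivAt (a := 0) (b := (t : ℝ))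
      (fun s _ => hasDerivAt_exp_smul_apply (Y n) U s)
      (Continuous.intervalIntegrable (continuous_iff_continuousAt.mpr fun r =>
        (hasDerivAt_exp_smul_apply (Y n) (Y n U) r).continuousAt) _ _)
    have h3 : NormedSpace.exp ((0 : ℝ) • Y n) (U : E) = U := by simp
    rw [h3] at h2
    change _ = NormedSpace.exp ((t : ℝ) • Y n) (U : E) - U
    rw [← h2]
    refine intervalIntegral.integral_congr fun s hs => ?_
    rw [uIcc_of_le t.coe_nonneg] at hs
    simp only [S]
    rw [Real.coe_toNNReal _ hs.1]
  have hd := ((hsg.continuous_toNNReal (A U)).integral_hasStrictDerivAt 0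
    0).hasDerivAt.tendsto_slope_zero_right
  rw [Real.toNNReal_zero, hsg.zero] at hd
  have hc : Tendsto (fun t : ℝ≥0 => (t : ℝ)) (𝓝[>] 0) (𝓝[>] 0) :=
    tendsto_nhdsWithin_iff.mpr ⟨(NNReal.continuous_coe.tendsto 0).mono_left nhdsWithin_le_nhds,
      by filter_upwards [self_mem_nhdsWithin] with t ht using by simpa using ht⟩
  refine (hd.comp hc).congr fun t => ?_
  simp only [Function.comp_apply, zero_add, intervalIntegral.integral_same, sub_zero]
  rw [hint, ← Complex.ofReal_inv, Complex.coe_smul]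

end HilleYosida

/-! ### Generation in an incomplete space through a finer complete norm. -/

section TwoNorms

variable {E K : Type*} [NormedAddCommGroup E] [InnerProductSpace ℂ E]
  [NormedAddCommGroup K] [InnerProductSpace ℂ K] [CompleteSpace K] {A : E →ₗ.[ℂ] E}

/-- An m-dissipative operator in a possibly incomplete space generates a contraction semigroup if
it is quasi-dissipative for a complete finer norm. -/
theorem IsMDissipative.exists_semigroup_of_finer_norm (hA : IsMDissipative A) (e : E ≃ₗ[ℂ] K)
    (he : ∀ x, ‖x‖ ≤ ‖e x‖) {κ : ℝ} (hκ : 0 ≤ κ)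
    (hAe : ∀ U : A.domain, (⟪e (U : E), e (A U)⟫_ℂ).re ≤ κ * ‖e (U : E)‖ ^ 2) :
    Dense (A.domain : Set E) ∧
      ∃ T : ℝ≥0 → E →L[ℂ] E, IsContractionSemigroup T ∧ IsGenerator A T := by
  let i : K →L[ℂ] E := e.symm.toLinearMap.mkContinuous 1 fun y => by
    have := he (e.symm y)
    simpa using this
  have hie : ∀ x, i (e x) = x := fun x => e.symm_apply_apply x
  have hei : ∀ y, e (i y) = y := fun y => e.apply_symm_apply y
  let d : Submodule ℂ K := A.domain.comap e.symm.toLinearMap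
  -- `B = e A e⁻¹ - κ`: the shift makes the transported operator m-dissipative in `K`, its range
  -- condition at `μ` being that of `A` at `μ + κ`.
  let B : K →ₗ.[ℂ] K :=
    { domain := d
      toFun := e.toLinearMap ∘ₗ A.toFun ∘ₗ
        (e.symm.toLinearMap.restrict (p := d) (q := A.domain) fun y hy => hy) -
          (κ : ℂ) • d.subtype }
  have hBdom : ∀ U : A.domain, e (U : E) ∈ B.domain := fun U => by
    change e.symm (e (U : E)) ∈ A.domain
    rw [e.symm_apply_apply]
    exact U.2
  have hB : ∀ U : A.domain, B ⟨e (U : E), hBdom U⟩ = e (A U) - (κ : ℂ) • e (U : E) := fun U => by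
    change e (A ⟨e.symm (e (U : E)), _⟩) - _ = _
    congr 3
    exact Subtype.ext (e.symm_apply_apply _)
  have hsurj : ∀ y : B.domain, ∃ U : A.domain, y = ⟨e (U : E), hBdom U⟩ := fun y =>
    ⟨⟨e.symm y, y.2⟩, Subtype.ext (e.apply_symm_apply _).symm⟩
  have hBm : IsMDissipative B := by
    refine ⟨fun y => ?_, fun μ hμ F => ?_⟩
    · obtain ⟨U, rfl⟩ := hsurj y
      rw [hB, inner_sub_right, inner_smul_right, Complex.sub_re, Complex.re_ofReal_mul]
      have : (⟪e (U : E), e (U : E)⟫_ℂ).re = ‖e (U : E)‖ ^ 2 := inner_self_eq_norm_sq (𝕜 := ℂ) _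
      rw [this]
      linarith [hAe U]
    · obtain ⟨U, hU⟩ := hA.2 (μ + κ) (by linarith) (e.symm F)
      refine ⟨⟨e (U : E), hBdom U⟩, ?_⟩
      rw [hB, ← e.apply_symm_apply F, ← hU, map_sub, map_smul, Complex.ofReal_add, add_smul]
      abel
  obtain ⟨S, hS, hSB⟩ := hBm.exists_semigroup
  have hdense : Dense (A.domain : Set E) := by
    have h1 : DenseRange i := (Function.RightInverse.surjective hie).denseRange
    refine (h1.dense_image i.continuous hBm.dense_domain).mono ?_
    rintro _ ⟨y, hy, rfl⟩
    exact hy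
  -- The exponential undoes the shift by `κ`. These maps are only linear for now: boundedness in the
  -- norm of `E` does not follow from boundedness in `K`.
  let T₀ : ℝ≥0 → E →ₗ[ℂ] E := fun t =>
    (Real.exp (κ * t) : ℂ) • (i.toLinearMap ∘ₗ (S t).toLinearMap ∘ₗ e.toLinearMap)
  have hT₀ : ∀ t x, T₀ t x = (Real.exp (κ * t) : ℂ) • i (S t (e x)) := fun t x => rfl
  have hT₀c : ∀ x, Continuous fun t => T₀ t x := fun x => by
    simp only [hT₀]
    refine Continuous.smul (by fun_prop) (i.continuous.comp (hS.continuous _))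
  have hder : ∀ (U : A.domain) (t : ℝ), 0 ≤ t → ∃ h : T₀ t.toNNReal (U : E) ∈ A.domain,
      HasDerivWithinAt (fun s : ℝ => T₀ s.toNNReal (U : E)) (A ⟨_, h⟩) (Ici 0) t := by
    intro U t ht
    obtain ⟨hm, hBS⟩ := hSB.orbit hS ⟨e (U : E), hBdom U⟩ t.toNNReal
    have hm' : T₀ t.toNNReal (U : E) ∈ A.domain := A.domain.smul_mem _ hm
    refine ⟨hm', ?_⟩
    have h1 := hSB.hasDerivWithinAt hS ⟨e (U : E), hBdom U⟩ ht
    have h2 := (i.restrictScalars ℝ).hasFDerivAt.comp_hasDerivWithinAt t h1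
    have h3 : HasDerivWithinAt (fun s => Real.exp (κ * s)) (Real.exp (κ * t) * κ) (Ici 0) t := by
      have := (((hasDerivAt_id t).const_mul κ).exp).hasDerivWithinAt (s := Ici 0)
      simpa using this
    have h4 := h3.smul h2
    have h5 : HasDerivWithinAt (fun s : ℝ => T₀ s.toNNReal (U : E)) _ (Ici 0) t :=
      h4.congr (fun s hs => by
        rw [hT₀, Real.coe_toNNReal _ hs, Complex.coe_smul]; rfl)
        (by rw [hT₀, Real.coe_toNNReal _ ht, Complex.coe_smul]; rfl)
    refine h5.congr_deriv ?_
    have h6 : A ⟨_, hm'⟩ = (Real.exp (κ * t) : ℂ) • A ⟨i (S t.toNNReal (e (U : E))), hm⟩ := by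
      rw [← A.map_smul]
      congr 1
      refine Subtype.ext ?_
      simp only [hT₀, Real.coe_toNNReal _ ht, Submodule.coe_smul]
    have h7 := hB ⟨i (S t.toNNReal (e (U : E))), hm⟩
    have h8 : (⟨e (i (S t.toNNReal (e (U : E)))), hBdom ⟨_, hm⟩⟩ : B.domain) =
        ⟨S t.toNNReal (e (U : E)), hm⟩ := Subtype.ext (hei _)
    simp only at h7
    rw [h8, hei, hBS] at h7
    rw [h6]
    simp only [Function.comp_apply, ContinuousLinearMap.coe_restrictScalars']
    rw [h7, map_sub, map_smul, hie, Complex.coe_smul, mul_smul, smul_sub, Complex.coe_smul]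
    abel
  -- Orbits from the domain solve `U' = A U` in `E`, so dissipativity in the original norm removes
  -- the growth factor.
  have hT₀n_dom : ∀ t (U : A.domain), ‖T₀ t (U : E)‖ ≤ ‖(U : E)‖ := by
    intro t U
    choose hm hd using hder U
    have h1 : T₀ 0 (U : E) = U := by simp [hT₀, hS.zero, hie]
    let g : ℝ → E := fun s => if h : 0 ≤ s then A ⟨_, hm s h⟩ else 0
    have h2 := norm_le_of_re_inner_deriv_nonpos (f := fun s : ℝ => T₀ s.toNNReal (U : E))
      (f' := g) (fun s hs => by simp only [g, dif_pos hs]; exact hd s hs)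
      (fun s hs => by simp only [g, dif_pos hs]; exact hA.1 ⟨_, hm s hs⟩) t.2
    simpa [h1] using h2
  have hT₀n : ∀ t x, ‖T₀ t x‖ ≤ ‖x‖ := by
    intro t x
    -- The closure is taken in `K`, where `y ↦ T₀ t (i y)` is known to be continuous.
    have hcl : IsClosed {y : K | ‖T₀ t (i y)‖ ≤ ‖i y‖} := by
      refine isClosed_le ?_ i.continuous.norm
      simp only [hT₀, hei]
      exact (continuous_const.smul (i.continuous.comp (S t).continuous)).norm
    have h1 := hBm.dense_domain.closure_eq ▸ hcl.closure_subset_iff.mpr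
      (fun y hy => hT₀n_dom t ⟨i y, hy⟩)
    have h2 := h1 (mem_univ (e x))
    simpa [hie] using h2
  let T : ℝ≥0 → E →L[ℂ] E := fun t => (T₀ t).mkContinuous 1 fun x => by simpa using hT₀n t x
  have hT : ∀ t x, T t x = T₀ t x := fun t x => rfl
  have hTs : IsContractionSemigroup T := by
    refine ⟨?_, fun s t => ?_, fun t => ?_, hT₀c⟩
    · refine ContinuousLinearMap.ext fun x => ?_
      simp [hT, hT₀, hS.zero, hie]
    · refine ContinuousLinearMap.ext fun x => ?_
      rw [ContinuousLinearMap.comp_apply]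
      simp only [hT, hT₀, map_smul, hei, hS.add, ContinuousLinearMap.comp_apply, smul_smul]
      congr 1
      rw [← Complex.ofReal_mul, ← Real.exp_add, NNReal.coe_add, mul_add]
    · exact LinearMap.mkContinuous_norm_le _ zero_le_one _
  refine ⟨hdense, T, hTs, hA.isGenerator hTs fun U => ?_⟩
  obtain ⟨h, hd⟩ := hder U 0 le_rfl
  have h0 : A ⟨_, h⟩ = A U := by
    congr 1
    refine Subtype.ext ?_
    simp [hT₀, hS.zero, hie]
  rw [h0] at hd
  have hd' := (hasDerivWithinAt_iff_tendsto_slope' self_notMem_Ioi).mp (hd.mono Ioi_subset_Ici_self)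
  have hc : Tendsto (fun t : ℝ≥0 => (t : ℝ)) (𝓝[>] 0) (𝓝[>] 0) :=
    tendsto_nhdsWithin_iff.mpr ⟨(NNReal.continuous_coe.tendsto 0).mono_left nhdsWithin_le_nhds,
      by filter_upwards [self_mem_nhdsWithin] with t ht using by simpa using ht⟩
  refine (hd'.comp hc).congr fun t => ?_
  simp [slope_def_module, hT, hT₀, hS.zero, hie, ← Complex.coe_smul]

end TwoNorms

/-! ### Primitives, integration by parts and weak derivatives. -/

section Primitives

/-- Increments of the primitive of `f` are dominated by those of the primitive of `‖f‖`, which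
reduces the claim to the real case. -/
theorem absolutelyContinuousOnInterval_primitive {f : ℝ → ℂ} {a b : ℝ}
    (hf : IntervalIntegrable f volume a b) :
    AbsolutelyContinuousOnInterval (fun x => ∫ t in a..x, f t) a b := by
  have h := hf.norm.absolutelyContinuousOnInterval_intervalIntegral (c := a) left_mem_uIcc
  rw [absolutelyContinuousOnInterval_iff] at h ⊢
  intro ε hε
  obtain ⟨δ, hδ, h⟩ := h ε hε
  refine ⟨δ, hδ, fun I hI hI' => lt_of_le_of_lt (Finset.sum_le_sum fun i hi => ?_) (h I hI hI')⟩
  have hm := hI.1 i hi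
  have h1 : ∀ x ∈ uIcc a b, IntervalIntegrable f volume a x := fun x hx =>
    hf.mono_set (uIcc_subset_uIcc left_mem_uIcc hx)
  rw [dist_eq_norm, dist_eq_norm, intervalIntegral.integral_interval_sub_left (h1 _ hm.1) (h1 _ hm.2),
    intervalIntegral.integral_interval_sub_left (h1 _ hm.1).norm (h1 _ hm.2).norm, Real.norm_eq_abs]
  exact intervalIntegral.norm_integral_le_abs_integral_norm

/-- Integration by parts for primitives of integrable functions. -/
theorem integral_mul_add_mul_of_primitive {f g F G : ℝ → ℂ} {a b : ℝ}
    (hf : IntervalIntegrable f volume a b) (hg : IntervalIntegrable g volume a b)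
    (hF : ∀ x ∈ uIcc a b, F x = F a + ∫ t in a..x, f t)
    (hG : ∀ x ∈ uIcc a b, G x = G a + ∫ t in a..x, g t) :
    ∫ x in a..b, (f x * G x + F x * g x) = F b * G b - F a * G a := by
  let F₁ : ℝ → ℂ := fun x => F a + ∫ t in a..x, f t
  let G₁ : ℝ → ℂ := fun x => G a + ∫ t in a..x, g t
  have hconst : ∀ c : ℂ, AbsolutelyContinuousOnInterval (fun _ : ℝ => c) a b := fun c =>
    (contDiffOn_const (c := c)).absolutelyContinuousOnInterval
  have hF₁ : AbsolutelyContinuousOnInterval F₁ a b :=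
    (hconst _).add (absolutelyContinuousOnInterval_primitive hf)
  have hG₁ : AbsolutelyContinuousOnInterval G₁ a b :=
    (hconst _).add (absolutelyContinuousOnInterval_primitive hg)
  let h : ℝ → ℂ := fun x => f x * G₁ x + F₁ x * g x
  have hh : IntervalIntegrable h volume a b :=
    (hf.mul_continuousOn hG₁.continuousOn).add (hg.continuousOn_mul hF₁.continuousOn)
  -- The product minus the primitive of its almost everywhere derivative is absolutely continuous
  -- with zero derivative, hence constant.
  obtain ⟨C, hC⟩ := ((hF₁.smul hG₁).sub
    (absolutelyContinuousOnInterval_primitive hh)).const_of_ae_hasDerivAt_zero (by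
      filter_upwards [hf.ae_hasDerivAt_integral, hg.ae_hasDerivAt_integral,
        hh.ae_hasDerivAt_integral] with x h1 h2 h3 hx
      have e1 := (h1 hx a left_mem_uIcc).const_add (F a)
      have e2 := (h2 hx a left_mem_uIcc).const_add (G a)
      refine ((e1.mul e2).sub (h3 hx a left_mem_uIcc)).congr_deriv ?_
      simp only [h, F₁, G₁]
      ring)
  have ha := hC a left_mem_uIcc
  have hb := hC b right_mem_uIcc
  have e1 : ∫ x in a..b, (f x * G x + F x * g x) = ∫ x in a..b, h x := by
    refine intervalIntegral.integral_congr fun x hx => ?_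
    simp only [h, F₁, G₁]
    rw [hF x hx, hG x hx]
  have e2 : F₁ b = F b := (hF b right_mem_uIcc).symm
  have e3 : G₁ b = G b := (hG b right_mem_uIcc).symm
  have e4 : F₁ a = F a := by simp [F₁]
  have e5 : G₁ a = G a := by simp [G₁]
  simp only [Pi.sub_apply, smul_eq_mul, intervalIntegral.integral_same, sub_zero] at ha hb
  rw [Pi.mul_apply] at ha hb
  rw [e4, e5] at ha
  rw [e2, e3] at hb
  rw [e1, ha, ← hb]
  ring

theorem IsTest01.exists_Ioo {φ : ℝ → ℝ} (h : IsTest01 φ) :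
    ∃ α β : ℝ, 0 < α ∧ α < 1 / 2 ∧ 1 / 2 < β ∧ β < 1 ∧ tsupport φ ⊆ Ioo α β := by
  -- Inserting `1 / 2` keeps the set nonempty when `φ = 0` and separates `α` from `β`.
  have hK : IsCompact (insert (1 / 2 : ℝ) (tsupport φ)) := h.compact.isCompact.insert _
  have hKs : insert (1 / 2 : ℝ) (tsupport φ) ⊆ Ioo 0 1 :=
    insert_subset (by norm_num) h.subset
  obtain ⟨α, hα⟩ := hK.exists_isLeast ⟨_, mem_insert _ _⟩
  obtain ⟨β, hβ⟩ := hK.exists_isGreatest ⟨_, mem_insert _ _⟩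
  have h1 := (hKs hα.1).1
  have h2 := (hKs hβ.1).2
  have h3 := hα.2 (mem_insert _ _)
  have h4 := hβ.2 (mem_insert _ _)
  refine ⟨α / 2, (1 + β) / 2, by linarith, by linarith, by linarith, by linarith, fun x hx => ?_⟩
  have h5 := hα.2 (mem_insert_of_mem _ hx)
  have h6 := hβ.2 (mem_insert_of_mem _ hx)
  constructor <;> linarith

theorem intervalIntegrable01 {G : ℝ → ℂ}
    (hG : LocallyIntegrableOn G (Ioo 0 1)) {x y : ℝ} (hx : x ∈ Ioo (0 : ℝ) 1)
    (hy : y ∈ Ioo (0 : ℝ) 1) : IntervalIntegrable G volume x y := by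
  have h1 : uIcc x y ⊆ Ioo 0 1 := ordConnected_Ioo.uIcc_subset hx hy
  exact (hG.integrableOn_compact_subset h1 isCompact_uIcc).intervalIntegrable

theorem continuousOn_primitive01 {G : ℝ → ℂ} (hG : LocallyIntegrableOn G (Ioo 0 1)) :
    ContinuousOn (fun x => ∫ t in (1 / 2)..x, G t) (Ioo 0 1) := by
  intro x hx
  have h1 : Icc (min x (1 / 2) / 2) ((1 + max x (1 / 2)) / 2) ∈ 𝓝 x := by
    apply Icc_mem_nhds
    · have := min_le_left x (1 / 2)
      rcases min_choice x (1 / 2) with h | h <;> rw [h] at this ⊢ <;> linarith [hx.1]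
    · have := le_max_left x (1 / 2)
      rcases max_choice x (1 / 2) with h | h <;> rw [h] at this ⊢ <;> linarith [hx.2]
  have h2 : 0 < min x (1 / 2) := lt_min hx.1 (by norm_num)
  have h3 : max x (1 / 2) < 1 := max_lt hx.2 (by norm_num)
  have h4 := min_le_right x (1 / 2)
  have h5 := le_max_right x (1 / 2)
  have h6 := intervalIntegral.continuousOn_primitive_interval' (a := 1 / 2)
    (intervalIntegrable01 hG (x := min x (1 / 2) / 2)
      (y := (1 + max x (1 / 2)) / 2)
      ⟨by linarith, by linarith⟩ ⟨by linarith, by linarith⟩)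
    (by rw [uIcc_of_le (by linarith)]; constructor <;> linarith)
  rw [uIcc_of_le (by linarith)] at h6
  exact (h6.continuousAt h1).continuousWithinAt

/-- A primitive of a locally integrable function has this function as its weak derivative. -/
theorem hasWeakDeriv01_primitive {G : ℝ → ℂ} (hG : LocallyIntegrableOn G (Ioo 0 1)) :
    HasWeakDeriv01 (fun x => ∫ t in (1 / 2)..x, G t) G where
  locInt := (continuousOn_primitive01 hG).locallyIntegrableOn measurableSet_Ioo
  locInt_deriv := hG
  integral_eq φ hφ := by
    obtain ⟨α, β, h0, h1, h2, h3, hs⟩ := hφ.exists_Ioo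
    let F : ℝ → ℂ := fun x => ∫ t in (1 / 2)..x, G t
    have hα : α ∈ Ioo (0 : ℝ) 1 := ⟨h0, by linarith⟩
    have hβ : β ∈ Ioo (0 : ℝ) 1 := ⟨by linarith, h3⟩
    have hh : (1 / 2 : ℝ) ∈ Ioo (0 : ℝ) 1 := by norm_num
    have hαβ : uIcc α β ⊆ Ioo 0 1 := ordConnected_Ioo.uIcc_subset hα hβ
    have hred : ∀ f : ℝ → ℂ, Function.support f ⊆ Ioo α β →
        ∫ x in Ioo 0 1, f x = ∫ x in α..β, f x := by
      intro f hf
      rw [intervalIntegral.integral_of_le (by linarith), integral_Ioc_eq_integral_Ioo,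
        setIntegral_eq_integral_of_forall_compl_eq_zero,
        setIntegral_eq_integral_of_forall_compl_eq_zero]
      · exact fun x hx => by_contra fun h => hx (hf h)
      · exact fun x hx => by_contra fun h => hx ⟨h0.trans (hf h).1, (hf h).2.trans h3⟩
    have hφ0 : ∀ x, x ∉ Ioo α β → φ x = 0 := fun x hx =>
      image_eq_zero_of_notMem_tsupport fun h => hx (hs h)
    have hφ0' : ∀ x, x ∉ Ioo α β → deriv φ x = 0 := fun x hx =>
      by_contra fun h => hx (hs (support_deriv_subset h))
    rw [hred _ fun x hx => by_contra fun h => hx (by simp [hφ0' x h]),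
      hred _ fun x hx => by_contra fun h => hx (by simp [hφ0 x h])]
    have hφd : ∀ x, HasDerivAt (fun x => (φ x : ℂ)) ((deriv φ x : ℝ) : ℂ) x := fun x =>
      ((hφ.smooth.differentiable (by simp)) x).hasDerivAt.ofReal_comp
    have hφc : Continuous fun x => ((deriv φ x : ℝ) : ℂ) :=
      Complex.continuous_ofReal.comp hφ.deriv.smooth.continuous
    have key := integral_mul_add_mul_of_primitive (a := α) (b := β) (F := fun x => (φ x : ℂ))
      (G := F) (f := fun x => ((deriv φ x : ℝ) : ℂ)) (g := G) (hφc.intervalIntegrable _ _)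
      (intervalIntegrable01 hG hα hβ)
      (fun x _ => by
        rw [intervalIntegral.integral_eq_sub_of_hasDerivAt (fun x _ => hφd x)
          (hφc.intervalIntegrable _ _)]
        ring)
      (fun x hx => (intervalIntegral.integral_add_adjacent_intervals
        (intervalIntegrable01 hG hh hα)
        (intervalIntegrable01 hG hα (hαβ hx))).symm)
    rw [intervalIntegral.integral_add, hφ0 α (by simp), hφ0 β (by simp)] at key
    · simp only [Complex.real_smul]
      rw [eq_neg_iff_add_eq_zero, key]
      simp
    · refine IntervalIntegrable.continuousOn_mul ?_ hφc.continuousOn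
      exact ((continuousOn_primitive01 hG).mono hαβ).intervalIntegrable
    · exact (intervalIntegrable01 hG hα hβ).continuousOn_mul
        (Complex.continuous_ofReal.comp hφ.smooth.continuous).continuousOn

/-- `F` minus the primitive of `G` has zero weak derivative, so it is constant. -/
theorem HasWeakDeriv01.ae_eq_primitive {F G : ℝ → ℂ} (h : HasWeakDeriv01 F G) :
    ∃ c : ℂ, F =ᵐ[leb01] fun x => c + ∫ t in (1 / 2)..x, G t := by
  have h1 := h.add ((hasWeakDeriv01_primitive h.locInt_deriv).const_smul (-1))
  obtain ⟨c, hc⟩ := (h1.congr (G' := fun _ => 0) (EventuallyEq.refl _ _)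
    (Eventually.of_forall fun x => by ring)).ae_const
  refine ⟨c, ?_⟩
  filter_upwards [hc] with x hx
  rw [← hx]
  ring

theorem intervalIntegrable_Lp01 (g : Lp ℂ 2 leb01) : IntervalIntegrable g volume 0 1 := by
  rw [intervalIntegrable_iff_integrableOn_Ioo_of_le zero_le_one]
  exact (Lp.memLp g).integrable one_le_two

theorem norm_sq_Lp {μ : Measure ℝ} (g : Lp ℂ 2 μ) : ‖g‖ ^ 2 = ∫ x, ‖g x‖ ^ 2 ∂μ := by
  rw [← inner_self_eq_norm_sq (𝕜 := ℂ), L2.inner_def]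
  simp only [inner_self_eq_norm_sq_to_K]
  have : ∫ x, (RCLike.ofReal ‖g x‖ : ℂ) ^ 2 ∂μ = ((∫ x, ‖g x‖ ^ 2 ∂μ : ℝ) : ℂ) := by
    rw [← integral_complex_ofReal]
    simp
  rw [this]
  simp

theorem integrable_norm_sq_Lp {μ : Measure ℝ} (g : Lp ℂ 2 μ) :
    Integrable (fun x => ‖g x‖ ^ 2) μ :=
  (memLp_two_iff_integrable_sq_norm (Lp.aestronglyMeasurable g)).mp (Lp.memLp g)

/-- Cauchy–Schwarz against the constant `1` on `(0, x)`. The factor `x` is what beats the degeneracy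
at `0`, both in Green's formula and in the completeness criterion. -/
theorem norm_primitive_sq_le (g : Lp ℂ 2 leb01) {x : ℝ} (hx : x ∈ Icc (0 : ℝ) 1) :
    ‖∫ t in (0 : ℝ)..x, g t‖ ^ 2 ≤ x * ‖g‖ ^ 2 := by
  have hm : MemLp g 2 (volume.restrict (Ioc 0 x)) := by
    have h1 : MemLp g 2 (volume.restrict (Ioo 0 x)) :=
      (Lp.memLp g).mono_measure (Measure.restrict_mono (Ioo_subset_Ioo_right hx.2) le_rfl)
    rwa [Measure.restrict_congr_set (Ioo_ae_eq_Ioc (a := (0 : ℝ)) (b := x))] at h1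
  let ν : Measure ℝ := volume.restrict (Ioc 0 x)
  let k : Lp ℂ 2 ν := hm.toLp _
  let e : Lp ℂ 2 ν := (memLp_const (1 : ℂ)).toLp _
  have h1 : ⟪e, k⟫_ℂ = ∫ t in (0 : ℝ)..x, g t := by
    rw [L2.inner_def, intervalIntegral.integral_of_le hx.1]
    refine integral_congr_ae ?_
    filter_upwards [hm.coeFn_toLp, (memLp_const (p := 2) (μ := ν) (1 : ℂ)).coeFn_toLp] with t h2 h3
    rw [h2, h3]
    simp
  have h2 : ‖e‖ ^ 2 = x := by
    rw [norm_sq_Lp]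
    have : ∫ t, ‖e t‖ ^ 2 ∂ν = ∫ t, (1 : ℝ) ∂ν := by
      refine integral_congr_ae ?_
      filter_upwards [(memLp_const (p := 2) (μ := ν) (1 : ℂ)).coeFn_toLp] with t h3
      rw [h3]
      simp
    rw [this]
    simp [ν, hx.1]
  have h3 : ‖k‖ ^ 2 ≤ ‖g‖ ^ 2 := by
    rw [norm_sq_Lp, norm_sq_Lp]
    have h4 : ∫ t, ‖k t‖ ^ 2 ∂ν = ∫ t, ‖g t‖ ^ 2 ∂ν := by
      refine integral_congr_ae ?_
      filter_upwards [hm.coeFn_toLp] with t h4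
      rw [h4]
    rw [h4]
    change ∫ t in Ioc 0 x, ‖g t‖ ^ 2 ≤ _
    rw [integral_Ioc_eq_integral_Ioo]
    exact setIntegral_mono_set (integrable_norm_sq_Lp g) (Eventually.of_forall fun t => by positivity)
      (Ioo_subset_Ioo_right hx.2).eventuallyLE
  rw [← h1]
  have h4 := norm_inner_le_norm (𝕜 := ℂ) e k
  calc ‖⟪e, k⟫_ℂ‖ ^ 2 ≤ (‖e‖ * ‖k‖) ^ 2 := by gcongr
    _ = x * ‖k‖ ^ 2 := by rw [mul_pow, h2]
    _ ≤ x * ‖g‖ ^ 2 := mul_le_mul_of_nonneg_left h3 hx.1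

end Primitives

/-! ### The space `H¹_{1/σ,0}`: primitives, closedness and test functions. -/

noncomputable section

namespace DegenerateWave

variable {D : DegenerateWave}

theorem primitive_half_eq (g : Lp ℂ 2 leb01) {x : ℝ} (hx : x ∈ Ioo (0 : ℝ) 1) :
    ∫ t in (1 / 2)..x, g t = -(∫ t in (0 : ℝ)..(1 / 2), g t) + ∫ t in (0 : ℝ)..x, g t := by
  have h := intervalIntegrable_Lp01 g
  have h1 : ∀ y ∈ Icc (0 : ℝ) 1, IntervalIntegrable g volume 0 y := fun y hy =>
    h.mono_set (by rw [uIcc_of_le hy.1, uIcc_of_le zero_le_one]; exact Icc_subset_Icc_right hy.2)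
  rw [← intervalIntegral.integral_interval_sub_left (h1 x ⟨hx.1.le, hx.2.le⟩)
    (h1 (1 / 2) (by norm_num))]
  ring

theorem continuousOn_primitive_Lp01 (g : Lp ℂ 2 leb01) :
    ContinuousOn (fun x => ∫ t in (0 : ℝ)..x, g t) (Icc 0 1) := by
  have := intervalIntegral.continuousOn_primitive_interval' (intervalIntegrable_Lp01 g)
    (a := 0) left_mem_uIcc
  rwa [uIcc_of_le zero_le_one] at this

/-- Elements of `H¹₀` are the primitives of mean-zero square integrable functions. -/
theorem hasH10Deriv_iff {u : D.L2w} {g : Lp ℂ 2 leb01} :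
    D.HasH10Deriv u g ↔
      u =ᵐ[leb01] (fun x => ∫ t in (0 : ℝ)..x, g t) ∧ ∫ t in (0 : ℝ)..1, g t = 0 := by
  constructor
  · rintro ⟨h1, w, hw, hwu, hw0, hw1⟩
    obtain ⟨c, hc⟩ := h1.ae_eq_primitive
    let c' : ℂ := c - ∫ t in (0 : ℝ)..(1 / 2), g t
    have hu : u =ᵐ[leb01] fun x => c' + ∫ t in (0 : ℝ)..x, g t := by
      filter_upwards [hc, ae_restrict_mem measurableSet_Ioo] with x hx hx'
      rw [hx, primitive_half_eq g hx']
      simp only [c']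
      ring
    have hwc : EqOn w (fun x => c' + ∫ t in (0 : ℝ)..x, g t) (Icc 0 1) :=
      Measure.eqOn_Icc_of_ae_eq volume zero_ne_one
        (Measure.restrict_congr_set (μ := (volume : Measure ℝ)) (Ioo_ae_eq_Icc (a := 0) (b := 1)) ▸
          hwu.trans hu) hw (continuousOn_const.add (continuousOn_primitive_Lp01 g))
    have hc0 : c' = 0 := by
      have := hwc (left_mem_Icc.mpr zero_le_one)
      simpa [hw0] using this.symm
    have hc1 := hwc (right_mem_Icc.mpr zero_le_one)
    simp only [hw1, hc0, zero_add] at hc1 hu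
    exact ⟨hu, hc1.symm⟩
  · rintro ⟨h1, h2⟩
    have hg : LocallyIntegrableOn g (Ioo 0 1) :=
      IntegrableOn.locallyIntegrableOn ((Lp.memLp g).integrable one_le_two)
    refine ⟨?_, fun x => ∫ t in (0 : ℝ)..x, g t, continuousOn_primitive_Lp01 g, h1.symm, by simp, h2⟩
    have h3 := hasWeakDeriv01_primitive hg
    let c : ℂ := ∫ t in (0 : ℝ)..(1 / 2), g t
    have h4 : HasWeakDeriv01 (fun _ => c) fun _ => 0 :=
      { locInt := locallyIntegrableOn_const c
        locInt_deriv := locallyIntegrableOn_zero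
        integral_eq := fun φ hφ => by
          simp only [smul_zero, integral_zero, neg_zero]
          rw [integral_smul_const, setIntegral_eq_integral_of_forall_compl_eq_zero (fun x hx =>
            by_contra fun h => hx (hφ.deriv.subset (subset_tsupport _ h))),
            integral_eq_zero_of_hasDerivAt_of_integrable (f := φ)
              (fun x => ((hφ.smooth.differentiable (by simp)) x).hasDerivAt)
              (hφ.deriv.smooth.continuous.integrable_of_hasCompactSupport hφ.deriv.compact)
              (hφ.smooth.continuous.integrable_of_hasCompactSupport hφ.compact), zero_smul] }
    refine (h3.add h4).congr ?_ (Eventually.of_forall fun x => by simp)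
    filter_upwards [h1, ae_restrict_mem measurableSet_Ioo] with x hx hx'
    rw [hx, primitive_half_eq g hx']
    simp only [c]
    ring

theorem integral_weight {F : Type*} [NormedAddCommGroup F] [NormedSpace ℝ F] (f : ℝ → F) :
    ∫ x, f x ∂D.weight = ∫ x in Ioo 0 1, (1 / D.sigma x) • f x := by
  have hm : AEMeasurable (fun x => ENNReal.ofReal (1 / D.sigma x)) leb01 :=
    ENNReal.measurable_ofReal.comp_aemeasurable
      ((continuousOn_const.div (D.sigma_cont.mono Ioo_subset_Icc_self)
        fun x hx => (D.sigma_pos hx).ne').aemeasurable measurableSet_Ioo)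
  rw [weight, integral_withDensity_eq_integral_toReal_smul₀ hm
    (Eventually.of_forall fun x => ENNReal.ofReal_lt_top)]
  refine integral_congr_ae ?_
  filter_upwards [ae_restrict_mem measurableSet_Ioo] with x hx
  rw [ENNReal.toReal_ofReal (one_div_pos.mpr (D.sigma_pos hx)).le]

theorem integrable_weight_iff {F : Type*} [NormedAddCommGroup F] [NormedSpace ℝ F] {f : ℝ → F} :
    Integrable f D.weight ↔ Integrable (fun x => (1 / D.sigma x) • f x) leb01 := by
  have hm : AEMeasurable (fun x => ENNReal.ofReal (1 / D.sigma x)) leb01 :=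
    ENNReal.measurable_ofReal.comp_aemeasurable
      ((continuousOn_const.div (D.sigma_cont.mono Ioo_subset_Icc_self)
        fun x hx => (D.sigma_pos hx).ne').aemeasurable measurableSet_Ioo)
  rw [weight, integrable_withDensity_iff_integrable_smul₀' hm
    (Eventually.of_forall fun x => ENNReal.ofReal_lt_top)]
  refine integrable_congr ?_
  filter_upwards [ae_restrict_mem measurableSet_Ioo] with x hx
  rw [ENNReal.toReal_ofReal (one_div_pos.mpr (D.sigma_pos hx)).le]

theorem inner_L2w (u v : D.L2w) :
    ⟪u, v⟫_ℂ = ∫ x in Ioo 0 1, conj (u x) * (v x / (D.sigma x : ℂ)) := by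
  rw [L2.inner_def, integral_weight]
  refine integral_congr_ae (Eventually.of_forall fun x => ?_)
  simp only [RCLike.inner_apply, Complex.real_smul, Complex.ofReal_div, Complex.ofReal_one]
  ring

theorem integrable_inner_L2w (u v : D.L2w) :
    Integrable (fun x => conj (u x) * (v x / (D.sigma x : ℂ))) leb01 := by
  have h := integrable_weight_iff.mp (L2.integrable_inner (𝕜 := ℂ) u v)
  refine h.congr (Eventually.of_forall fun x => ?_)
  simp only [RCLike.inner_apply, Complex.real_smul, Complex.ofReal_div, Complex.ofReal_one]
  ring

theorem norm_sq_V (u : D.V) : ‖u‖ ^ 2 = ∫ x in Ioo 0 1, D.eta x * ‖D.dx u x‖ ^ 2 := by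
  have h := inner_self_eq_norm_sq (𝕜 := ℂ) u
  rw [inner_V, innerV_self] at h
  rw [← h]
  exact Complex.ofReal_re _

theorem integrable_eta_mul_sq (u : D.V) :
    Integrable (fun x => D.eta x * ‖D.dx u x‖ ^ 2) leb01 := by
  refine (D.integrable_eta (D.dx u) (D.dx u)).re.congr (ae_of_all _ fun x => ?_)
  simp only [Complex.conj_mul']
  norm_cast

variable (D) in
-- Although `a` vanishes at `0`, integrability of `b / a` keeps `η` continuous and positive on `[0,
-- 1]`, hence bounded below. The upper bound gives the converse estimate that follows.
theorem exists_mul_norm_dx_le : ∃ c : ℝ, 0 < c ∧ ∀ u : D.V, c * ‖D.dx u‖ ^ 2 ≤ ‖u‖ ^ 2 := by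
  obtain ⟨y, -, hy⟩ := isCompact_Icc.exists_isMinOn (nonempty_Icc.mpr zero_le_one) D.eta_cont
  refine ⟨D.eta y, D.eta_pos y, fun u => ?_⟩
  rw [norm_sq_V, norm_sq_Lp, ← integral_const_mul]
  refine integral_mono_ae ((integrable_norm_sq_Lp _).const_mul _) (integrable_eta_mul_sq u) ?_
  filter_upwards [ae_restrict_mem measurableSet_Ioo] with x hx
  exact mul_le_mul_of_nonneg_right (hy (Ioo_subset_Icc_self hx)) (by positivity)

variable (D) in
theorem exists_norm_le_mul_norm_dx : ∃ C : ℝ, 0 < C ∧ ∀ u : D.V, ‖u‖ ^ 2 ≤ C * ‖D.dx u‖ ^ 2 := by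
  obtain ⟨y, -, hy⟩ := isCompact_Icc.exists_isMaxOn (nonempty_Icc.mpr zero_le_one) D.eta_cont
  refine ⟨D.eta y, D.eta_pos y, fun u => ?_⟩
  rw [norm_sq_V, norm_sq_Lp, ← integral_const_mul]
  refine integral_mono_ae (integrable_eta_mul_sq u) ((integrable_norm_sq_Lp _).const_mul _) ?_
  filter_upwards [ae_restrict_mem measurableSet_Ioo] with x hx
  exact mul_le_mul_of_nonneg_right (hy (Ioo_subset_Icc_self hx)) (by positivity)

/-- Constructor for elements of `H¹_{1/σ,0}`. -/
theorem exists_V {u : D.L2w} {g : Lp ℂ 2 leb01} (h : D.HasH10Deriv u g) :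
    ∃ v : D.V, D.incl v = u ∧ D.dx v = g :=
  let v : D.V := ⟨u, g, h⟩
  ⟨v, rfl, (D.dx_spec v).unique h⟩

/-- Convergence of the derivatives makes the primitives converge pointwise, and a subsequence of `u
n` converges almost everywhere to `u'`, so the limits agree. Both convergences are assumed because
the inclusion into `L²_{1/σ}` need not be bounded. -/
theorem HasH10Deriv.of_tendsto {u : ℕ → D.L2w} {g : ℕ → Lp ℂ 2 leb01} {u' : D.L2w}
    {g' : Lp ℂ 2 leb01} (h : ∀ n, D.HasH10Deriv (u n) (g n)) (hu : Tendsto u atTop (𝓝 u'))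
    (hg : Tendsto g atTop (𝓝 g')) : D.HasH10Deriv u' g' := by
  have hprim : ∀ x ∈ Icc (0 : ℝ) 1, Tendsto (fun n => ∫ t in (0 : ℝ)..x, g n t) atTop
      (𝓝 (∫ t in (0 : ℝ)..x, g' t)) := by
    intro x hx
    rw [tendsto_iff_norm_sub_tendsto_zero]
    have hi : ∀ k : Lp ℂ 2 leb01, IntervalIntegrable k volume 0 x := fun k =>
      (intervalIntegrable_Lp01 k).mono_set
        (by rw [uIcc_of_le hx.1, uIcc_of_le zero_le_one]; exact Icc_subset_Icc_right hx.2)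
    refine squeeze_zero (fun n => norm_nonneg _) (fun n => ?_)
      (tendsto_iff_norm_sub_tendsto_zero.mp hg)
    have e : (∫ t in (0 : ℝ)..x, g n t) - ∫ t in (0 : ℝ)..x, g' t =
        ∫ t in (0 : ℝ)..x, (g n - g') t := by
      rw [← intervalIntegral.integral_sub (hi _) (hi _), intervalIntegral.integral_of_le hx.1,
        intervalIntegral.integral_of_le hx.1, integral_Ioc_eq_integral_Ioo,
        integral_Ioc_eq_integral_Ioo]
      refine integral_congr_ae (ae_restrict_of_ae_restrict_of_subset
        (Ioo_subset_Ioo_right hx.2) ?_)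
      filter_upwards [Lp.coeFn_sub (g n) g'] with t ht
      rw [ht, Pi.sub_apply]
    rw [e]
    have h1 := norm_primitive_sq_le (g n - g') hx
    refine le_of_sq_le_sq (h1.trans ?_) (norm_nonneg _)
    exact mul_le_of_le_one_left (by positivity) hx.2
  refine hasH10Deriv_iff.mpr ⟨?_, ?_⟩
  · obtain ⟨ns, hns, hae⟩ := (tendstoInMeasure_of_tendsto_Lp hu).exists_seq_tendsto_ae
    have hall : ∀ᵐ x ∂leb01, ∀ n, u n x = ∫ t in (0 : ℝ)..x, g n t :=
      ae_all_iff.mpr fun n => (hasH10Deriv_iff.mp (h n)).1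
    filter_upwards [D.ac_weight.ae_le hae, hall, ae_restrict_mem measurableSet_Ioo] with x h1 h2 hx
    refine tendsto_nhds_unique h1
      (((hprim x ⟨hx.1.le, hx.2.le⟩).comp hns.tendsto_atTop).congr fun n => (h2 _).symm)
  · refine tendsto_nhds_unique (hprim 1 (by norm_num)) ?_
    simp only [fun n => (hasH10Deriv_iff.mp (h n)).2]
    exact tendsto_const_nhds

/-- The graph of the inclusion of `H¹_{1/σ,0}` in `L²_{1/σ}` is complete. -/
theorem exists_tendsto_V {u : ℕ → D.V} (hu : CauchySeq u) (hu' : CauchySeq fun n => D.incl (u n)) :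
    ∃ v : D.V, Tendsto u atTop (𝓝 v) ∧ Tendsto (fun n => D.incl (u n)) atTop (𝓝 (D.incl v)) := by
  obtain ⟨c, hc, hc'⟩ := D.exists_mul_norm_dx_le
  obtain ⟨C, hC, hC'⟩ := D.exists_norm_le_mul_norm_dx
  have hdx : CauchySeq fun n => D.dx (u n) := by
    rw [Metric.cauchySeq_iff] at hu ⊢
    intro ε hε
    obtain ⟨N, hN⟩ := hu (√c * ε) (by positivity)
    refine ⟨N, fun m hm n hn => ?_⟩
    have h1 := hN m hm n hn
    have h2 := hc' (u m - u n)
    rw [dist_eq_norm] at h1 ⊢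
    rw [← map_sub]
    have h3 : ‖u m - u n‖ ^ 2 < c * ε ^ 2 := by
      calc _ < (√c * ε) ^ 2 := pow_lt_pow_left₀ h1 (norm_nonneg _) two_ne_zero
        _ = _ := by rw [mul_pow, Real.sq_sqrt hc.le]
    have h4 := lt_of_mul_lt_mul_left (h2.trans_lt h3) hc.le
    exact lt_of_pow_lt_pow_left₀ 2 hε.le h4
  obtain ⟨w, hw⟩ := cauchySeq_tendsto_of_complete hu'
  obtain ⟨g, hg⟩ := cauchySeq_tendsto_of_complete hdx
  obtain ⟨v, hv, hv'⟩ := exists_V (HasH10Deriv.of_tendsto (fun n => D.dx_spec (u n)) hw hg)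
  refine ⟨v, ?_, hv ▸ hw⟩
  rw [tendsto_iff_norm_sub_tendsto_zero] at hg ⊢
  refine squeeze_zero (fun n => norm_nonneg _) (fun n => ?_)
    (g := fun n => √C * ‖D.dx (u n) - g‖) (by simpa using hg.const_mul √C)
  have h1 := hC' (u n - v)
  rw [map_sub, hv'] at h1
  refine le_of_sq_le_sq (h1.trans_eq ?_) (by positivity)
  rw [mul_pow, Real.sq_sqrt hC.le]

/-- A test function as an element of `H¹_{1/σ,0}`. -/
theorem exists_V_of_test {φ : ℝ → ℝ} (hφ : IsTest01 φ) :
    ∃ v : D.V, D.incl v =ᵐ[leb01] (fun x => (φ x : ℂ)) ∧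
      D.dx v =ᵐ[leb01] fun x => ((deriv φ x : ℝ) : ℂ) := by
  have hc : Continuous fun x => (φ x : ℂ) :=
    Complex.continuous_ofReal.comp hφ.smooth.continuous
  have hc' : Continuous fun x => ((deriv φ x : ℝ) : ℂ) :=
    Complex.continuous_ofReal.comp hφ.deriv.smooth.continuous
  have h1 : MemLp (fun x => (φ x : ℂ)) 2 D.weight := by
    refine (memLp_two_iff_integrable_sq_norm hc.aestronglyMeasurable).mpr
      (integrable_weight_iff.mpr ?_)
    have h2 : LocallyIntegrableOn (fun x => ((φ x / D.sigma x : ℝ) : ℂ)) (Ioo 0 1) := by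
      refine ContinuousOn.locallyIntegrableOn ?_ measurableSet_Ioo
      exact Complex.continuous_ofReal.comp_continuousOn
        (hφ.smooth.continuous.continuousOn.div (D.sigma_cont.mono Ioo_subset_Icc_self)
          fun x hx => (D.sigma_pos hx).ne')
    refine (hφ.integrableOn_smul h2).re.congr (Eventually.of_forall fun x => ?_)
    simp only [Complex.real_smul, Complex.norm_real, Real.norm_eq_abs, sq_abs, smul_eq_mul]
    rw [← Complex.ofReal_mul]
    change φ x * (φ x / D.sigma x) = _
    ring
  have h2 : MemLp (fun x => ((deriv φ x : ℝ) : ℂ)) 2 leb01 :=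
    (hc'.memLp_of_hasCompactSupport
      (hφ.deriv.compact.comp_left Complex.ofReal_zero)).mono_measure Measure.restrict_le_self
  have h3 := D.ac_weight.ae_eq h1.coeFn_toLp
  have hφ0 : ∀ x, x ∉ Ioo (0 : ℝ) 1 → φ x = 0 := fun x hx =>
    image_eq_zero_of_notMem_tsupport fun h => hx (hφ.subset h)
  have h4 : ∀ x ∈ Icc (0 : ℝ) 1, ∫ t in (0 : ℝ)..x, h2.toLp _ t = φ x := by
    intro x hx
    have h5 : ∫ t in (0 : ℝ)..x, h2.toLp _ t = ∫ t in (0 : ℝ)..x, ((deriv φ t : ℝ) : ℂ) := by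
      rw [intervalIntegral.integral_of_le hx.1, intervalIntegral.integral_of_le hx.1,
        integral_Ioc_eq_integral_Ioo, integral_Ioc_eq_integral_Ioo]
      exact integral_congr_ae (ae_restrict_of_ae_restrict_of_subset
        (Ioo_subset_Ioo_right hx.2) h2.coeFn_toLp)
    rw [h5, intervalIntegral.integral_eq_sub_of_hasDerivAt (f := fun x => (φ x : ℂ))
      (fun x _ => ((hφ.smooth.differentiable (by simp)) x).hasDerivAt.ofReal_comp)
      (hc'.intervalIntegrable _ _), hφ0 0 (by simp)]
    simp
  obtain ⟨v, hv, hv'⟩ := exists_V (u := h1.toLp _) (g := h2.toLp _) (D := D)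
    (hasH10Deriv_iff.mpr ⟨by
      filter_upwards [h3, ae_restrict_mem measurableSet_Ioo] with x h5 hx
      rw [h5, h4 x (Ioo_subset_Icc_self hx)], by
      rw [h4 1 (by norm_num), hφ0 1 (by simp)]; simp⟩)
  exact ⟨v, hv ▸ h3, hv' ▸ h2.coeFn_toLp⟩

end DegenerateWave

end

/-! ### Green's formula, dissipativity and the formal adjoint. -/

noncomputable section

section ProdL2

variable (E F : Type*) [NormedAddCommGroup E] [InnerProductSpace ℂ E]
  [NormedAddCommGroup F] [InnerProductSpace ℂ F]

/-- The isometry `(x, y) ↦ (x, -y)`. -/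
def negSnd : WithLp 2 (E × F) ≃ₗᵢ[ℂ] WithLp 2 (E × F) where
  toFun U := WithLp.toLp 2 (U.fst, -U.snd)
  invFun U := WithLp.toLp 2 (U.fst, -U.snd)
  map_add' U W := by
    refine WithLp.ofLp_injective 2 (Prod.ext rfl ?_)
    change -(U.snd + W.snd) = -U.snd + -W.snd
    abel
  map_smul' c U := by
    refine WithLp.ofLp_injective 2 (Prod.ext rfl ?_)
    change -(c • U.snd) = c • -U.snd
    rw [smul_neg]
  left_inv U := WithLp.ofLp_injective 2 (Prod.ext rfl (neg_neg U.snd))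
  right_inv U := WithLp.ofLp_injective 2 (Prod.ext rfl (neg_neg U.snd))
  norm_map' U := by
    rw [← sq_eq_sq₀ (norm_nonneg _) (norm_nonneg _), WithLp.prod_norm_sq_eq_of_L2,
      WithLp.prod_norm_sq_eq_of_L2]
    change ‖U.fst‖ ^ 2 + ‖-U.snd‖ ^ 2 = _
    rw [norm_neg]

end ProdL2

namespace DegenerateWave

variable {D : DegenerateWave}

/-- Away from `0`, and up to `1` since `a(1) > 0`, the weight `1 / σ` is bounded by some `C`; then
`|f| ≤ |f|² + 1` gives `|f| / σ ≤ |f|² / σ + C`. -/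
theorem integrableOn_div_sigma (f : D.L2w) {ε : ℝ} (hε : 0 < ε) :
    IntegrableOn (fun x => f x / (D.sigma x : ℂ)) (Ioo ε 1) := by
  have hsub : Icc ε 1 ⊆ Icc 0 1 := Icc_subset_Icc_left hε.le
  obtain ⟨C, hC⟩ := isCompact_Icc.exists_bound_of_continuousOn
    (f := fun x => 1 / D.sigma x) (s := Icc ε 1) (continuousOn_const.div (D.sigma_cont.mono hsub)
      fun x hx => (div_pos (D.a_pos x ⟨hε.trans_le hx.1, hx.2⟩) (D.eta_pos x)).ne')
  have h1 : IntegrableOn (fun x => (1 / D.sigma x) • ‖f x‖ ^ 2) (Ioo ε 1) :=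
    (integrable_weight_iff.mp (integrable_norm_sq_Lp f)).mono_measure
      (Measure.restrict_mono (Ioo_subset_Ioo_left hε.le) le_rfl)
  have h2 : IntegrableOn (fun x => (1 / D.sigma x) • ‖f x‖ ^ 2 + C) (Ioo ε 1) :=
    h1.add (integrableOn_const (by simp))
  refine h2.mono' ?_ ?_
  · have h3 : AEStronglyMeasurable f (volume.restrict (Ioo ε 1)) :=
      ((Lp.aestronglyMeasurable f).mono_ac D.ac_weight).mono_measure
        (Measure.restrict_mono (Ioo_subset_Ioo_left hε.le) le_rfl)
    have h4 : ContinuousOn (fun x => ((1 / D.sigma x : ℝ) : ℂ)) (Ioo ε 1) :=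
      Complex.continuous_ofReal.comp_continuousOn (continuousOn_const.div
        (D.sigma_cont.mono (Ioo_subset_Icc_self.trans hsub))
        fun x hx => (D.sigma_pos ⟨hε.trans hx.1, hx.2⟩).ne')
    refine (h3.mul (h4.aestronglyMeasurable measurableSet_Ioo)).congr
      (Eventually.of_forall fun x => ?_)
    simp [div_eq_mul_inv]
  · filter_upwards [ae_restrict_mem measurableSet_Ioo] with x hx
    have hs : 0 < 1 / D.sigma x := one_div_pos.mpr (D.sigma_pos ⟨hε.trans hx.1, hx.2⟩)
    have h3 := hC x (Ioo_subset_Icc_self hx)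
    rw [Real.norm_of_nonneg hs.le] at h3
    rw [norm_div, Complex.norm_real, Real.norm_of_nonneg (one_div_pos.mp hs).le, smul_eq_mul,
      div_eq_mul_one_div]
    nlinarith [sq_nonneg (‖f x‖ - 1), mul_nonneg hs.le (sq_nonneg (‖f x‖ - 1)), norm_nonneg (f x)]

theorem locallyIntegrableOn_div_sigma (f : D.L2w) :
    LocallyIntegrableOn (fun x => f x / (D.sigma x : ℂ)) (Ioo 0 1) := fun x hx =>
  ⟨Ioo (x / 2) 1, mem_nhdsWithin_of_mem_nhds (Ioo_mem_nhds (by linarith [hx.1]) hx.2),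
    integrableOn_div_sigma f (half_pos hx.1)⟩

/-- If `L ≠ 0`, then `‖L‖² / 4 ≤ x M ‖w x‖²` near `0`, so `1 / x` would be dominated by a multiple
of the integrable `‖w‖²`. This kills the boundary term at the degenerate end. -/
theorem tendsto_zero_of_mul_sq_integrable {q w : ℝ → ℂ} {M : ℝ} {L : ℂ}
    (hq : ∀ x ∈ Ioo (0 : ℝ) 1, ‖q x‖ ^ 2 ≤ x * M)
    (hw : IntegrableOn (fun x => ‖w x‖ ^ 2) (Ioo 0 1))
    (h : Tendsto (fun x => q x * w x) (𝓝[>] 0) (𝓝 L)) : L = 0 := by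
  by_contra hL
  have hL' : 0 < ‖L‖ := norm_pos_iff.mpr hL
  have h1 : ∀ᶠ x in 𝓝[>] (0 : ℝ), ‖L‖ / 2 < ‖q x * w x‖ :=
    h.norm.eventually_const_lt (half_lt_self hL')
  obtain ⟨δ, hδ, h2⟩ := (mem_nhdsGT_iff_exists_Ioo_subset).mp h1
  let δ' := min δ 1
  have hδ' : 0 < δ' := lt_min hδ one_pos
  have h3 : IntegrableOn (fun x => 4 * M / ‖L‖ ^ 2 * ‖w x‖ ^ 2) (Ioo 0 δ') :=
    (hw.mono_set (Ioo_subset_Ioo_right (min_le_right _ _))).const_mul _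
  have h4 : IntegrableOn (fun x : ℝ => x⁻¹) (Ioo 0 δ') := by
    refine h3.mono' measurable_inv.aestronglyMeasurable ?_
    filter_upwards [ae_restrict_mem measurableSet_Ioo] with x hx
    have h5 : ‖L‖ / 2 < ‖q x * w x‖ := h2 ⟨hx.1, hx.2.trans_le (min_le_left _ _)⟩
    have h6 := hq x ⟨hx.1, hx.2.trans_le (min_le_right _ _)⟩
    rw [norm_mul] at h5
    have h7 : (‖L‖ / 2) ^ 2 ≤ (‖q x‖ * ‖w x‖) ^ 2 := by gcongr
    rw [mul_pow] at h7
    have h8 : ‖q x‖ ^ 2 * ‖w x‖ ^ 2 ≤ x * M * ‖w x‖ ^ 2 := by gcongr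
    rw [Real.norm_of_nonneg (inv_nonneg.mpr hx.1.le), div_mul_eq_mul_div,
      le_div_iff₀ (by positivity), inv_mul_le_iff₀ hx.1]
    nlinarith
  have h5 : IntervalIntegrable (fun x : ℝ => x⁻¹) volume 0 δ' :=
    (intervalIntegrable_iff_integrableOn_Ioo_of_le hδ'.le).mpr h4
  rcases _root_.intervalIntegrable_inv_iff.mp h5 with h6 | h6
  · exact hδ'.ne h6
  · exact h6 left_mem_uIcc

/-- Green's formula. -/
theorem HasB.innerV_eq {u : D.V} {f : D.L2w} (h : D.HasB u f) (v : D.V) :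
    D.innerV v u = -⟪D.incl v, f⟫_ℂ := by
  obtain ⟨c, hc⟩ := HasWeakDeriv01.ae_eq_primitive h
  obtain ⟨hv, hv1⟩ := hasH10Deriv_iff.mp (D.dx_spec v)
  set k : ℝ → ℂ := fun x => f x / (D.sigma x : ℂ) with hk
  -- The continuous representative of `η u_x`; `q` below is that of `v̄`.
  let w : ℝ → ℂ := fun x => c + ∫ t in (1 / 2)..x, k t
  let g : ℝ → ℂ := fun x => conj (D.dx v x)
  let q : ℝ → ℂ := fun x => conj (∫ t in (0 : ℝ)..x, D.dx v t)
  have hq : ∀ x, q x = ∫ t in (0 : ℝ)..x, g t := fun x => intervalIntegral.intervalIntegral_conj.symm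
  have hkint : ∀ x ∈ Ioc (0 : ℝ) 1, ∀ y ∈ Ioc (0 : ℝ) 1, IntervalIntegrable k volume x y := by
    have h1 : ∀ x ∈ Ioc (0 : ℝ) 1, IntervalIntegrable k volume x 1 := fun x hx =>
      (intervalIntegrable_iff_integrableOn_Ioo_of_le hx.2).mpr (integrableOn_div_sigma f hx.1)
    exact fun x hx y hy => (h1 x hx).trans (h1 y hy).symm
  have hgint : IntervalIntegrable g volume 0 1 := by
    have h1 := intervalIntegrable_Lp01 (D.dx v)
    rw [intervalIntegrable_iff] at h1 ⊢
    exact (Complex.conjCLE.toContinuousLinearMap.integrable_comp h1)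
  have hgint' : ∀ x ∈ Icc (0 : ℝ) 1, ∀ y ∈ Icc (0 : ℝ) 1, IntervalIntegrable g volume x y :=
    fun x hx y hy => hgint.mono_set (by
      rw [uIcc_of_le zero_le_one]; exact ordConnected_Icc.uIcc_subset hx hy)
  have i1 : Integrable (fun x => g x * w x) leb01 := by
    refine (D.integrable_eta (D.dx v) (D.dx u)).congr ?_
    filter_upwards [hc] with x hx
    simp only [g, w, ← hx]
    ring
  have i2 : Integrable (fun x => q x * k x) leb01 := by
    refine (integrable_inner_L2w (D.incl v) f).congr ?_
    filter_upwards [hv] with x hx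
    simp only [q, k, hx]
  have e1 : D.innerV v u = ∫ x in Ioo 0 1, g x * w x := by
    refine integral_congr_ae ?_
    filter_upwards [hc] with x hx
    simp only [g, w, ← hx]
    ring
  have e2 : ⟪D.incl v, f⟫_ℂ = ∫ x in Ioo 0 1, q x * k x := by
    rw [inner_L2w]
    refine integral_congr_ae ?_
    filter_upwards [hv] with x hx
    simp only [q, k, hx]
  let H : ℝ → ℂ := fun x => g x * w x + q x * k x
  have hH : IntervalIntegrable H volume 0 1 :=
    (intervalIntegrable_iff_integrableOn_Ioo_of_le zero_le_one).mpr (i1.add i2)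
  have e3 : D.innerV v u + ⟪D.incl v, f⟫_ℂ = ∫ x in (0 : ℝ)..1, H x := by
    rw [e1, e2, ← integral_add i1 i2, intervalIntegral.integral_of_le zero_le_one,
      integral_Ioc_eq_integral_Ioo]
  -- Integration by parts is valid only on `[x, 1]`, as `k` need not be integrable at `0`. The whole
  -- integrand `H` is integrable on `(0, 1)`, so `q w` has a limit at `0`, and this limit must be
  -- zero.
  have key : ∀ x ∈ Ioo (0 : ℝ) 1, ∫ t in x..1, H t = -(q x * w x) := by
    intro x hx
    have hh : (1 / 2 : ℝ) ∈ Ioc (0 : ℝ) 1 := by norm_num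
    have := integral_mul_add_mul_of_primitive (a := x) (b := 1) (f := g) (g := k) (F := q) (G := w)
      (hgint' x ⟨hx.1.le, hx.2.le⟩ 1 (by norm_num)) (hkint x ⟨hx.1, hx.2.le⟩ 1 (by norm_num))
      (fun y hy => by
        rw [uIcc_of_le hx.2.le] at hy
        rw [hq, hq, intervalIntegral.integral_add_adjacent_intervals
          (hgint' 0 (by norm_num) x ⟨hx.1.le, hx.2.le⟩)
          (hgint' x ⟨hx.1.le, hx.2.le⟩ y ⟨hx.1.le.trans hy.1, hy.2⟩)])
      (fun y hy => by
        rw [uIcc_of_le hx.2.le] at hy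
        simp only [w]
        rw [add_assoc, intervalIntegral.integral_add_adjacent_intervals
          (hkint _ hh x ⟨hx.1, hx.2.le⟩)
          (hkint x ⟨hx.1, hx.2.le⟩ y ⟨hx.1.trans_le hy.1, hy.2⟩)])
    have hq1 : q 1 = 0 := by simp [q, hv1]
    rw [hq1, zero_mul, zero_sub] at this
    exact this
  have hlim : Tendsto (fun x => q x * w x) (𝓝[>] 0) (𝓝 (-∫ x in (0 : ℝ)..1, H x)) := by
    have h1 := intervalIntegral.continuousOn_primitive_interval' hH (a := 0) left_mem_uIcc
    rw [uIcc_of_le zero_le_one] at h1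
    have h2 := (h1 0 (by norm_num)).mono_left
      (nhdsWithin_mono 0 (Ioo_subset_Icc_self (a := (0 : ℝ)) (b := 1)))
    rw [nhdsWithin_Ioo_eq_nhdsGT one_pos] at h2
    have h3 := h2.sub_const (∫ x in (0 : ℝ)..1, H x)
    simp only [intervalIntegral.integral_same, zero_sub] at h3
    refine h3.congr' ?_
    filter_upwards [Ioo_mem_nhdsGT one_pos] with x hx
    have h4 := intervalIntegral.integral_add_adjacent_intervals (a := 0) (b := x) (c := 1) (f := H)
      (μ := volume)
      (hH.mono_set (by
        rw [uIcc_of_le hx.1.le, uIcc_of_le zero_le_one]; exact Icc_subset_Icc_right hx.2.le))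
      (hH.mono_set (by
        rw [uIcc_of_le hx.2.le, uIcc_of_le zero_le_one]; exact Icc_subset_Icc_left hx.1.le))
    rw [key x hx] at h4
    linear_combination h4
  have hw2 : IntegrableOn (fun x => ‖w x‖ ^ 2) (Ioo 0 1) := by
    have h1 : MemLp (fun x => (D.eta x : ℂ) * D.dx u x) 2 leb01 :=
      MemLp.smul (φ := fun x => (D.eta x : ℂ)) (Lp.memLp _) D.eta_memLp
    have h2 := (memLp_two_iff_integrable_sq_norm h1.1).mp h1
    refine Integrable.congr h2 ?_
    filter_upwards [hc] with x hx
    rw [hx]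
  have h0 := tendsto_zero_of_mul_sq_integrable (M := ‖D.dx v‖ ^ 2) (fun x hx => by
    simp only [q, RCLike.norm_conj]
    exact norm_primitive_sq_le _ ⟨hx.1.le, hx.2.le⟩) hw2 hlim
  rw [neg_eq_zero, ← e3] at h0
  exact eq_neg_of_add_eq_zero_left h0

theorem inner_mulH (u v : D.L2w) :
    ⟪u, D.mulH v⟫_ℂ = ∫ x, (D.h x : ℂ) * (conj (u x) * v x) ∂D.weight := by
  rw [L2.inner_def]
  refine integral_congr_ae ?_
  have h1 : D.mulH v =ᵐ[D.weight] fun x => (D.h x : ℂ) * v x := (D.mulH_memLp v).coeFn_toLp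
  filter_upwards [h1] with x hx
  rw [hx]
  simp only [RCLike.inner_apply]
  ring

theorem inner_mulH_left (u v : D.L2w) : ⟪D.mulH u, v⟫_ℂ = ⟪u, D.mulH v⟫_ℂ := by
  rw [← inner_conj_symm, inner_mulH, inner_mulH, ← integral_conj]
  refine integral_congr_ae (Eventually.of_forall fun x => ?_)
  simp only [map_mul, Complex.conj_conj, Complex.conj_ofReal]
  ring

theorem re_inner_mulH_nonneg (v : D.L2w) : 0 ≤ (⟪v, D.mulH v⟫_ℂ).re := by
  have h1 : ⟪v, D.mulH v⟫_ℂ = ((∫ x, D.h x * ‖v x‖ ^ 2 ∂D.weight : ℝ) : ℂ) := by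
    rw [inner_mulH, ← integral_complex_ofReal]
    refine integral_congr_ae (Eventually.of_forall fun x => ?_)
    simp only [Complex.conj_mul']
    push_cast
    rfl
  rw [h1, Complex.ofReal_re]
  refine integral_nonneg_of_ae ?_
  filter_upwards [D.weight_ac.ae_le D.h_nonneg] with x hx
  exact mul_nonneg hx (by positivity)

variable (D) in
theorem exists_norm_mulH_le : ∃ C : ℝ, ∀ v : D.L2w, ‖D.mulH v‖ ≤ C * ‖v‖ := by
  refine ⟨(eLpNormEssSup D.h leb01).toReal, fun v => ?_⟩
  refine Lp.norm_le_mul_norm_of_ae_le_mul ?_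
  have h1 : D.mulH v =ᵐ[D.weight] fun x => (D.h x : ℂ) * v x := (D.mulH_memLp v).coeFn_toLp
  have h2 : ∀ᵐ x ∂leb01, ‖D.h x‖ ≤ (eLpNormEssSup D.h leb01).toReal := by
    have h3 := D.h_bdd.2
    rw [eLpNorm_exponent_top] at h3
    filter_upwards [ae_le_eLpNormEssSup (f := D.h) (μ := leb01)] with x hx
    rw [← toReal_enorm]
    exact ENNReal.toReal_mono h3.ne hx
  filter_upwards [h1, D.weight_ac.ae_le h2] with x h3 h4
  rw [h3, norm_mul, Complex.norm_real]
  exact mul_le_mul_of_nonneg_right h4 (norm_nonneg _)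

variable (D) in
/-- Multiplication by the damping coefficient as a bounded operator. -/
def mulHL : D.L2w →L[ℂ] D.L2w :=
  D.mulH.mkContinuous D.exists_norm_mulH_le.choose D.exists_norm_mulH_le.choose_spec

theorem innerV_conj_symm (u w : D.V) : conj (D.innerV w u) = D.innerV u w :=
  D.core.conj_inner_symm u w

variable (D) in
-- By Green's formula `⟨u, v⟩` in `V` is minus the conjugate of `⟨v, B u⟩`, so these terms cancel in
-- real part and only `-⟨v, h v⟩` remains.
theorem isDissipative_A : IsDissipative D.A := by
  intro U
  rw [D.A_apply U, inner_energy]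
  have h1 := (D.B_spec (D.domFst U)).innerV_eq (D.toV (D.domSnd U))
  rw [← innerV_conj_symm] at h1
  have h2 : D.incl (D.toV (D.domSnd U)) = (U : D.Energy).snd := rfl
  rw [h2] at h1
  have h3 : D.innerV (U : D.Energy).fst (D.toV (D.domSnd U)) =
      -conj ⟪(U : D.Energy).snd, D.B (D.domFst U)⟫_ℂ := by
    rw [← map_neg, ← h1, Complex.conj_conj]
    rfl
  change (D.innerV (U : D.Energy).fst (D.toV (D.domSnd U)) +
    ⟪(U : D.Energy).snd, D.B (D.domFst U) - D.mulH (U : D.Energy).snd⟫_ℂ).re ≤ 0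
  rw [h3, inner_sub_right]
  simp only [Complex.add_re, Complex.neg_re, Complex.conj_re, Complex.sub_re]
  linarith [re_inner_mulH_nonneg (U : D.Energy).snd]

variable (D) in
/-- Reversal of the velocity, `(u, v) ↦ (u, -v)`. -/
def reverse : D.Energy ≃ₗᵢ[ℂ] D.Energy := negSnd D.V D.L2w

/-- `B` is symmetric, the coupling of position and velocity is skew, and the damping is symmetric.
Changing the sign of the velocity therefore conjugates `A` into its adjoint; this is what the
uniqueness argument needs. -/
theorem isAdjointPair_reverse (U : D.A.domain) :
    IsAdjointPair D.A (D.reverse U) (D.reverse (D.A U)) := by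
  intro V
  have h1 := (D.B_spec (D.domFst V)).innerV_eq (D.toV (D.domSnd U))
  have h2 := (D.B_spec (D.domFst U)).innerV_eq (D.toV (D.domSnd V))
  have h3 := inner_mulH_left (U : D.Energy).snd (V : D.Energy).snd
  have h4 := innerV_conj_symm ((D.domFst U : D.H2zero) : D.V) (D.toV (D.domSnd V))
  rw [h2, map_neg, inner_conj_symm] at h4
  have h5 : D.incl (D.toV (D.domSnd U)) = (U : D.Energy).snd := rfl
  have h6 : D.incl (D.toV (D.domSnd V)) = (V : D.Energy).snd := rfl
  have h7 : ((D.domFst U : D.H2zero) : D.V) = (U : D.Energy).fst := rfl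
  have h8 : ((D.domFst V : D.H2zero) : D.V) = (V : D.Energy).fst := rfl
  rw [h5, h8] at h1
  rw [h6, h7] at h4
  rw [D.A_apply U, D.A_apply V, inner_energy, inner_energy]
  change D.innerV (U : D.Energy).fst (D.toV (D.domSnd V)) +
    ⟪-(U : D.Energy).snd, D.B (D.domFst V) - D.mulH (V : D.Energy).snd⟫_ℂ =
    D.innerV (D.toV (D.domSnd U)) (V : D.Energy).fst +
      ⟪-(D.B (D.domFst U) - D.mulH (U : D.Energy).snd), (V : D.Energy).snd⟫_ℂ
  rw [h1, ← h4, inner_neg_left, inner_neg_left, inner_sub_left, inner_sub_right, h3]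
  ring

end DegenerateWave

end

/-! ### Graph norms and the Lax–Milgram lemma. -/

noncomputable section

section Graph

variable {E F : Type*} [NormedAddCommGroup E] [InnerProductSpace ℂ E]
  [NormedAddCommGroup F] [InnerProductSpace ℂ F]

/-- The graph of a linear map, with the Hilbert sum norm. -/
def graphL2 (j : E →ₗ[ℂ] F) : Submodule ℂ (WithLp 2 (E × F)) where
  carrier := {p | p.snd = j p.fst}
  add_mem' {p q} hp hq := by
    change p.snd + q.snd = j (p.fst + q.fst)
    rw [map_add, ← hp.out, ← hq.out]
  zero_mem' := (map_zero j).symm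
  smul_mem' c p hp := by
    change c • p.snd = j (c • p.fst)
    rw [map_smul, ← hp.out]

/-- A space is linearly equivalent to the graph of a linear map on it. -/
def equivGraphL2 (j : E →ₗ[ℂ] F) : E ≃ₗ[ℂ] graphL2 j where
  toFun x := ⟨WithLp.toLp 2 (x, j x), rfl⟩
  invFun p := p.1.fst
  map_add' x y := Subtype.ext (WithLp.ofLp_injective 2 (Prod.ext rfl (map_add j x y)))
  map_smul' c x := Subtype.ext (WithLp.ofLp_injective 2 (Prod.ext rfl (map_smul j c x)))
  left_inv _ := rfl
  right_inv p := Subtype.ext (WithLp.ofLp_injective 2 (Prod.ext rfl p.2.symm))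

theorem inner_equivGraphL2 (j : E →ₗ[ℂ] F) (x y : E) :
    ⟪equivGraphL2 j x, equivGraphL2 j y⟫_ℂ = ⟪x, y⟫_ℂ + ⟪j x, j y⟫_ℂ := rfl

theorem norm_equivGraphL2_sq (j : E →ₗ[ℂ] F) (x : E) :
    ‖equivGraphL2 j x‖ ^ 2 = ‖x‖ ^ 2 + ‖j x‖ ^ 2 :=
  WithLp.prod_norm_sq_eq_of_L2 (WithLp.toLp 2 (x, j x))

theorem norm_le_norm_equivGraphL2 (j : E →ₗ[ℂ] F) (x : E) : ‖x‖ ≤ ‖equivGraphL2 j x‖ :=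
  le_of_sq_le_sq (by rw [norm_equivGraphL2_sq]; nlinarith [sq_nonneg ‖j x‖]) (norm_nonneg _)

theorem norm_apply_le_norm_equivGraphL2 (j : E →ₗ[ℂ] F) (x : E) : ‖j x‖ ≤ ‖equivGraphL2 j x‖ :=
  le_of_sq_le_sq (by rw [norm_equivGraphL2_sq]; nlinarith [sq_nonneg ‖x‖]) (norm_nonneg _)

/-- The hypothesis is completeness of `E` for the graph norm in sequential form; neither `E` nor `F`
itself has to be complete. -/
theorem completeSpace_graphL2 {j : E →ₗ[ℂ] F}
    (h : ∀ u : ℕ → E, CauchySeq u → CauchySeq (fun n => j (u n)) →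
      ∃ x, Tendsto u atTop (𝓝 x) ∧ Tendsto (fun n => j (u n)) atTop (𝓝 (j x))) :
    CompleteSpace (graphL2 j) := by
  refine Metric.complete_of_cauchySeq_tendsto fun p hp => ?_
  let u : ℕ → E := fun n => (equivGraphL2 j).symm (p n)
  have hpu : ∀ n, equivGraphL2 j (u n) = p n := fun n => (equivGraphL2 j).apply_symm_apply _
  have hsub : ∀ m n, p m - p n = equivGraphL2 j (u m - u n) := fun m n => by
    rw [map_sub, hpu, hpu]
  have h1 : CauchySeq u := by
    rw [Metric.cauchySeq_iff] at hp ⊢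
    intro ε hε
    obtain ⟨N, hN⟩ := hp ε hε
    refine ⟨N, fun m hm n hn => lt_of_le_of_lt ?_ (hN m hm n hn)⟩
    rw [dist_eq_norm, dist_eq_norm, hsub]
    exact norm_le_norm_equivGraphL2 j _
  have h2 : CauchySeq fun n => j (u n) := by
    rw [Metric.cauchySeq_iff] at hp ⊢
    intro ε hε
    obtain ⟨N, hN⟩ := hp ε hε
    refine ⟨N, fun m hm n hn => lt_of_le_of_lt ?_ (hN m hm n hn)⟩
    rw [dist_eq_norm, dist_eq_norm, hsub, ← map_sub]
    exact norm_apply_le_norm_equivGraphL2 j _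
  obtain ⟨x, hx, hjx⟩ := h u h1 h2
  refine ⟨equivGraphL2 j x, ?_⟩
  rw [tendsto_iff_norm_sub_tendsto_zero] at hx hjx ⊢
  have h3 : Tendsto (fun n => √(‖u n - x‖ ^ 2 + ‖j (u n) - j x‖ ^ 2)) atTop (𝓝 0) := by
    have := ((hx.pow 2).add (hjx.pow 2)).sqrt
    simpa using this
  refine h3.congr fun n => ?_
  rw [← hpu, ← map_sub, ← map_sub, ← norm_equivGraphL2_sq, Real.sqrt_sq (norm_nonneg _)]

/-- The Lax–Milgram lemma for `u + j* M j u = j* z`. -/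
theorem exists_inner_add_inner_eq [CompleteSpace F] (j : E →ₗ[ℂ] F) [CompleteSpace (graphL2 j)]
    (M : F →L[ℂ] F) {c : ℝ} (hc : 0 < c) (hM : ∀ y, c * ‖y‖ ^ 2 ≤ (⟪y, M y⟫_ℂ).re) (z : F) :
    ∃ u : E, ∀ φ : E, ⟪φ, u⟫_ℂ + ⟪j φ, M (j u)⟫_ℂ = ⟪j φ, z⟫_ℂ := by
  let i : graphL2 j →L[ℂ] F := (j ∘ₗ (equivGraphL2 j).symm.toLinearMap).mkContinuous 1 fun p => by
    have := norm_apply_le_norm_equivGraphL2 j ((equivGraphL2 j).symm p)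
    rw [LinearEquiv.apply_symm_apply] at this
    simpa using this
  have hi : ∀ x, i (equivGraphL2 j x) = j x := fun x => rfl
  -- The graph inner product already contains `⟨j x, j y⟩`, hence `M - 1` rather than `M`. The form
  -- of `P` is coercive with constant `min 1 c`.
  let P : graphL2 j →L[ℂ] graphL2 j := 1 + (ContinuousLinearMap.adjoint i).comp ((M - 1).comp i)
  have hP : ∀ x y, ⟪equivGraphL2 j x, P (equivGraphL2 j y)⟫_ℂ = ⟪x, y⟫_ℂ + ⟪j x, M (j y)⟫_ℂ := by
    intro x y
    have e : P (equivGraphL2 j y) = equivGraphL2 j y +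
      ContinuousLinearMap.adjoint i (M (j y) - j y) := rfl
    rw [e, inner_add_right, ContinuousLinearMap.adjoint_inner_right, hi, inner_equivGraphL2,
      inner_sub_right]
    ring
  let m : ℝ≥0 := ⟨min 1 c, (lt_min one_pos hc).le⟩
  have hu : IsUnit P := by
    refine ContinuousLinearMap.isUnit_of_forall_le_norm_inner_map P (c := m)
      (lt_min one_pos hc : (0 : ℝ) < min 1 c) fun p => ?_
    obtain ⟨x, rfl⟩ := (equivGraphL2 j).surjective p
    rw [← inner_conj_symm, RCLike.norm_conj, hP, norm_equivGraphL2_sq]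
    refine le_trans ?_ (Complex.re_le_norm _)
    have h1 : (⟪x, x⟫_ℂ).re = ‖x‖ ^ 2 := inner_self_eq_norm_sq (𝕜 := ℂ) x
    rw [Complex.add_re, h1]
    have h2 : (m : ℝ) ≤ 1 := min_le_left 1 c
    have h3 : (m : ℝ) ≤ c := min_le_right 1 c
    have h4 := hM (j x)
    nlinarith [sq_nonneg ‖x‖, sq_nonneg ‖j x‖]
  obtain ⟨p, hp⟩ := (ContinuousLinearMap.isUnit_iff_bijective.mp hu).2
    (ContinuousLinearMap.adjoint i z)
  obtain ⟨u, rfl⟩ := (equivGraphL2 j).surjective p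
  refine ⟨u, fun φ => ?_⟩
  rw [← hP, hp, ContinuousLinearMap.adjoint_inner_right, hi]

/-- An m-dissipative operator `A` generates a contraction semigroup if there is a linear map `j`
with complete graph such that `j ∘ A` is bounded. -/
theorem IsMDissipative.exists_semigroup_of_graph {A : E →ₗ.[ℂ] E} (hA : IsMDissipative A)
    (j : E →ₗ[ℂ] F) [CompleteSpace (graphL2 j)] (hj : ∀ U : A.domain, ‖j (A U)‖ ≤ ‖(U : E)‖) :
    Dense (A.domain : Set E) ∧
      ∃ T : ℝ≥0 → E →L[ℂ] E, IsContractionSemigroup T ∧ IsGenerator A T := by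
  refine hA.exists_semigroup_of_finer_norm (equivGraphL2 j)
    -- Only the added term can be positive, and `‖j U‖ ‖j (A U)‖` is at most the squared graph norm,
    -- whence `κ = 1`.
    (norm_le_norm_equivGraphL2 j) (κ := 1) zero_le_one fun U => ?_
  rw [inner_equivGraphL2, Complex.add_re]
  have h1 := hA.1 U
  have h2 : (⟪j U, j (A U)⟫_ℂ).re ≤ ‖j U‖ * ‖j (A U)‖ :=
    (Complex.re_le_norm _).trans (norm_inner_le_norm _ _)
  have h3 := mul_le_mul (norm_apply_le_norm_equivGraphL2 j (U : E))
    ((hj U).trans (norm_le_norm_equivGraphL2 j (U : E))) (norm_nonneg _) (norm_nonneg _)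
  rw [one_mul, sq]
  linarith

end Graph

/-! ### The wave operator: range condition, generation and completeness. -/

namespace DegenerateWave

variable {D : DegenerateWave}

instance : CompleteSpace (graphL2 D.incl) := completeSpace_graphL2 fun _ => exists_tendsto_V

/-- The converse of Green's formula: test functions belong to `H¹_{1/σ,0}`, and on them the
variational identity is the definition of the weak derivative. -/
theorem HasB.of_innerV_eq {u : D.V} {f : D.L2w}
    (h : ∀ v : D.V, D.innerV v u = -⟪D.incl v, f⟫_ℂ) : D.HasB u f where
  locInt := by
    have h1 : MemLp (fun x => (D.eta x : ℂ) * D.dx u x) 2 leb01 :=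
      MemLp.smul (φ := fun x => (D.eta x : ℂ)) (Lp.memLp _) D.eta_memLp
    exact IntegrableOn.locallyIntegrableOn (h1.integrable one_le_two)
  locInt_deriv := locallyIntegrableOn_div_sigma f
  integral_eq φ hφ := by
    obtain ⟨v, hv, hv'⟩ := exists_V_of_test (D := D) hφ
    have h1 := h v
    rw [inner_L2w] at h1
    calc _ = D.innerV v u := by
          refine integral_congr_ae ?_
          filter_upwards [hv'] with x hx
          rw [hx, Complex.real_smul, Complex.conj_ofReal]
          ring
      _ = _ := h1
      _ = _ := by
          congr 1
          refine integral_congr_ae ?_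
          filter_upwards [hv] with x hx
          rw [hx, Complex.real_smul, Complex.conj_ofReal]

variable (D) in
-- Substituting `v = μ u - f` in `μ v - B u + h v = g` gives `(μ² + μ h) u - B u = g + μ f + h f`.
-- Its weak form is coercive with constant `μ²` because `h ≥ 0`.
theorem isMDissipative_A : IsMDissipative D.A := by
  refine ⟨D.isDissipative_A, fun μ hμ G => ?_⟩
  have hcoer : ∀ y : D.L2w, μ ^ 2 * ‖y‖ ^ 2 ≤
      (⟪y, ((μ ^ 2 : ℝ) • (1 : D.L2w →L[ℂ] D.L2w) + μ • D.mulHL) y⟫_ℂ).re := by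
    intro y
    have e : ((μ ^ 2 : ℝ) • (1 : D.L2w →L[ℂ] D.L2w) + μ • D.mulHL) y =
      ((μ ^ 2 : ℝ) : ℂ) • y + (μ : ℂ) • D.mulH y := rfl
    have h1 : (⟪y, y⟫_ℂ).re = ‖y‖ ^ 2 := inner_self_eq_norm_sq (𝕜 := ℂ) y
    rw [e, inner_add_right, inner_smul_right, inner_smul_right, Complex.add_re,
      Complex.re_ofReal_mul, Complex.re_ofReal_mul, h1]
    nlinarith [re_inner_mulH_nonneg y]
  let f : D.V := G.fst
  let g : D.L2w := G.snd
  obtain ⟨u, hu⟩ := exists_inner_add_inner_eq D.incl _ (by positivity : 0 < μ ^ 2) hcoer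
    (g + (μ : ℂ) • D.incl f + D.mulH (D.incl f))
  let v : D.V := (μ : ℂ) • u - f
  let k : D.L2w := (μ : ℂ) • D.incl v + D.mulH (D.incl v) - g
  have hk : D.HasB u k := by
    refine HasB.of_innerV_eq fun φ => ?_
    have h1 := hu φ
    have e : ((μ ^ 2 : ℝ) • (1 : D.L2w →L[ℂ] D.L2w) + μ • D.mulHL) (D.incl u) =
      ((μ ^ 2 : ℝ) : ℂ) • D.incl u + (μ : ℂ) • D.mulH (D.incl u) := rfl
    rw [inner_V, e] at h1
    rw [eq_sub_of_add_eq h1, ← inner_sub_right, ← inner_neg_right]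
    congr 1
    simp only [k, v, map_sub, map_smul, smul_sub, smul_smul]
    rw [Complex.ofReal_pow, sq]
    abel
  let U : D.Energy := WithLp.toLp 2 (u, D.incl v)
  have hU : U ∈ D.A.domain := ⟨⟨k, hk⟩, v.2⟩
  refine ⟨⟨U, hU⟩, ?_⟩
  have hB : D.B (D.domFst ⟨U, hU⟩) = k := (D.B_spec _).unique hk
  have hA : D.A ⟨U, hU⟩ = WithLp.toLp 2 (v, D.B (D.domFst ⟨U, hU⟩) - D.mulH (D.incl v)) :=
    D.A_apply ⟨U, hU⟩
  rw [hA, hB]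
  refine WithLp.ofLp_injective 2 (Prod.ext ?_ ?_)
  · change (μ : ℂ) • u - v = f
    simp [v]
  · change (μ : ℂ) • D.incl v - (k - D.mulH (D.incl v)) = g
    simp only [k]
    abel

variable (D) in
/-- The position component `(u, v) ↦ u`, with values in `L²_{1/σ}`. -/
def position : D.Energy →ₗ[ℂ] D.L2w where
  toFun U := D.incl U.fst
  map_add' U W := map_add D.incl U.fst W.fst
  map_smul' c U := map_smul D.incl c U.fst

theorem norm_fst_le_energy (U : D.Energy) : ‖U.fst‖ ≤ ‖U‖ :=
  le_of_sq_le_sq (by rw [WithLp.prod_norm_sq_eq_of_L2]; nlinarith [sq_nonneg ‖U.snd‖])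
    (norm_nonneg _)

theorem norm_snd_le_energy (U : D.Energy) : ‖U.snd‖ ≤ ‖U‖ :=
  le_of_sq_le_sq (by rw [WithLp.prod_norm_sq_eq_of_L2]; nlinarith [sq_nonneg ‖U.fst‖])
    (norm_nonneg _)

instance : CompleteSpace (graphL2 D.position) := completeSpace_graphL2 fun U hU hU' => by
  have h1 : CauchySeq fun n => (U n).fst := by
    rw [Metric.cauchySeq_iff] at hU ⊢
    intro ε hε
    obtain ⟨N, hN⟩ := hU ε hε
    refine ⟨N, fun m hm n hn => lt_of_le_of_lt ?_ (hN m hm n hn)⟩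
    rw [dist_eq_norm, dist_eq_norm]
    exact norm_fst_le_energy (U m - U n)
  have h2 : CauchySeq fun n => (U n).snd := by
    rw [Metric.cauchySeq_iff] at hU ⊢
    intro ε hε
    obtain ⟨N, hN⟩ := hU ε hε
    refine ⟨N, fun m hm n hn => lt_of_le_of_lt ?_ (hN m hm n hn)⟩
    rw [dist_eq_norm, dist_eq_norm]
    exact norm_snd_le_energy (U m - U n)
  obtain ⟨u, hu, hu'⟩ := exists_tendsto_V h1 hU'
  obtain ⟨v, hv⟩ := cauchySeq_tendsto_of_complete h2
  refine ⟨WithLp.toLp 2 (u, v), ?_, hu'⟩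
  exact ((WithLp.prod_continuous_toLp 2 D.V D.L2w).tendsto (u, v)).comp (hu.prodMk_nhds hv)

variable (D) in
-- The position of `A U` is the velocity of `U`, which the energy norm bounds. Thus the energy norm
-- completed by the `L²_{1/σ}` norm of the position meets the graph criterion.
theorem exists_semigroup_A : Dense (D.A.domain : Set D.Energy) ∧
    ∃ T : ℝ≥0 → D.Energy →L[ℂ] D.Energy, IsContractionSemigroup T ∧ IsGenerator D.A T := by
  refine D.isMDissipative_A.exists_semigroup_of_graph D.position fun U => ?_
  have h : D.position (D.A U) = (U : D.Energy).snd := by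
    rw [D.A_apply U]
    rfl
  rw [h]
  exact norm_snd_le_energy (U : D.Energy)

/-- Under the monotonicity condition the inclusion `H¹_{1/σ,0} → L²_{1/σ}` is bounded. -/
theorem exists_norm_incl_le {α δ : ℝ} (hα2 : α < 2) (hδ : 0 < δ)
    (hmono : MonotoneOn (fun x => x ^ α / D.a x) (Ioo 0 δ)) :
    ∃ C : ℝ, ∀ u : D.V, ‖D.incl u‖ ≤ C * ‖u‖ := by
  obtain ⟨c, hc, hc'⟩ := D.exists_mul_norm_dx_le
  have hcont : ContinuousOn (fun x => x / D.sigma x) (Ioc 0 1) :=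
    continuousOn_id.div (D.sigma_cont.mono Ioc_subset_Icc_self)
      fun x hx => (div_pos (D.a_pos x hx) (D.eta_pos x)).ne'
  let r : ℝ := min δ 1 / 2
  have hr : 0 < r := half_pos (lt_min hδ one_pos)
  have hrδ : r < δ := (half_lt_self (lt_min hδ one_pos)).trans_le (min_le_left _ _)
  have hr1 : r < 1 := (half_lt_self (lt_min hδ one_pos)).trans_le (min_le_right _ _)
  obtain ⟨K, hK⟩ := isCompact_Icc.exists_bound_of_continuousOn D.eta_cont
  have hint : IntegrableOn (fun x => x / D.sigma x) (Ioo 0 1) := by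
    have h1 : IntegrableOn (fun x => x / D.sigma x) (Ioc 0 r) := by
      have h2 : IntegrableOn (fun x : ℝ => K * (r ^ α / D.a r) * x ^ (1 - α)) (Ioc 0 r) := by
        have := intervalIntegral.intervalIntegrable_rpow' (a := 0) (b := r) (r := 1 - α)
          (by linarith)
        exact ((intervalIntegrable_iff_integrableOn_Ioc_of_le hr.le).mp this).const_mul _
      refine h2.mono' ((hcont.mono (Ioc_subset_Ioc_right hr1.le)).aestronglyMeasurable
        measurableSet_Ioc) ?_
      filter_upwards [ae_restrict_mem measurableSet_Ioc] with x hx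
      have hx1 : x ∈ Ioc (0 : ℝ) 1 := ⟨hx.1, hx.2.trans hr1.le⟩
      have ha := D.a_pos x hx1
      have h3 := hmono ⟨hx.1, hx.2.trans_lt hrδ⟩ ⟨hr, hrδ⟩ hx.2
      simp only at h3
      have h4 := hK x (Ioc_subset_Icc_self hx1)
      rw [Real.norm_of_nonneg (D.eta_pos x).le] at h4
      -- Near `0` the middle factor is at most its value at `r` by monotonicity, and `x ^ (1 - α)`
      -- is integrable since `α < 2`.
      have h5 : x / D.sigma x = D.eta x * (x ^ α / D.a x) * x ^ (1 - α) := by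
        have h6 : x ^ α * x ^ (1 - α) = x := by
          rw [← Real.rpow_add hx.1]; simp
        rw [sigma, div_div_eq_mul_div]
        nth_rewrite 1 [← h6]
        ring
      have h7 : 0 ≤ x ^ (1 - α) := Real.rpow_nonneg hx.1.le _
      have h8 : 0 ≤ x ^ α / D.a x := div_nonneg (Real.rpow_nonneg hx.1.le _) ha.le
      rw [h5, Real.norm_of_nonneg (by have := D.eta_pos x; positivity)]
      exact mul_le_mul_of_nonneg_right
        (mul_le_mul h4 h3 h8 ((D.eta_pos x).le.trans h4)) h7
    have h2 : IntegrableOn (fun x => x / D.sigma x) (Icc r 1) :=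
      (hcont.mono fun x hx => ⟨hr.trans_le hx.1, hx.2⟩).integrableOn_compact isCompact_Icc
    exact (h1.union h2).mono_set fun x hx => (le_total x r).imp (fun h => ⟨hx.1, h⟩)
      fun h => ⟨h, hx.2.le⟩
  let I : ℝ := ∫ x in Ioo 0 1, x / D.sigma x
  have hI : 0 ≤ I := setIntegral_nonneg measurableSet_Ioo fun x hx =>
    div_nonneg hx.1.le (D.sigma_pos hx).le
  refine ⟨√(I / c), fun u => ?_⟩
  have h1 : ‖D.incl u‖ ^ 2 ≤ I * ‖D.dx u‖ ^ 2 := by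
    rw [norm_sq_Lp, integral_weight, ← integral_mul_const]
    refine integral_mono_ae (integrable_weight_iff.mp (integrable_norm_sq_Lp _))
      (hint.mul_const _) ?_
    filter_upwards [(hasH10Deriv_iff.mp (D.dx_spec u)).1, ae_restrict_mem measurableSet_Ioo]
      with x hx hx'
    rw [hx, smul_eq_mul, div_mul_eq_mul_div, one_mul, div_mul_eq_mul_div]
    exact div_le_div_of_nonneg_right (norm_primitive_sq_le _ ⟨hx'.1.le, hx'.2.le⟩)
      (D.sigma_pos hx').le
  refine le_of_sq_le_sq ?_ (by positivity)
  rw [mul_pow, Real.sq_sqrt (by positivity), div_mul_eq_mul_div, le_div_iff₀ hc]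
  nlinarith [hc' u, mul_le_mul_of_nonneg_left (hc' u) hI]

/-- A bounded inclusion makes sequences Cauchy in `V` also Cauchy in `L²_{1/σ}`, so completeness for
the sum of the two norms applies. -/
theorem completeSpace_energy {C : ℝ} (h : ∀ u : D.V, ‖D.incl u‖ ≤ C * ‖u‖) :
    CompleteSpace D.Energy := by
  have : CompleteSpace D.V := by
    refine Metric.complete_of_cauchySeq_tendsto fun u hu => ?_
    have h1 : CauchySeq fun n => D.incl (u n) :=
      (D.incl.mkContinuous C h).uniformContinuous.comp_cauchySeq hu
    obtain ⟨v, hv, -⟩ := exists_tendsto_V hu h1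
    exact ⟨v, hv⟩
  infer_instance

end DegenerateWave

end

/-! ### The main theorem. -/

theorem mainTheorem3 (D : DegenerateWave) :
    -- if `x ^ α / a` is non-decreasing near `0` for some `α < 2`, the energy space is complete
    ((∃ α : ℝ, 0 < α ∧ α < 2 ∧ ∃ δ : ℝ, 0 < δ ∧ MonotoneOn (fun x => x ^ α / D.a x) (Ioo 0 δ)) →
      CompleteSpace D.Energy) ∧
    -- the wave operator is m-dissipative
    IsMDissipative D.A ∧
    -- it generates a strongly continuous semigroup of contractions
    (∃ T : ℝ≥0 → D.Energy →L[ℂ] D.Energy, IsContractionSemigroup T ∧ IsGenerator D.A T) ∧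
    -- weak solutions
    (∀ U₀ : D.Energy, ∃ U : ℝ → D.Energy, IsWeakSolution D.A U₀ U ∧
      ∀ W : ℝ → D.Energy, IsWeakSolution D.A U₀ W → EqOn W U (Ici 0)) ∧
    -- strong solutions
    (∀ U₀ ∈ D.A.domain, ∃ U : ℝ → D.Energy, IsStrongSolution D.A U₀ U ∧
      ∀ W : ℝ → D.Energy, IsStrongSolution D.A U₀ W → EqOn W U (Ici 0)) := by
  obtain ⟨hd, T, hT, hG⟩ := D.exists_semigroup_A
  refine ⟨?_, D.isMDissipative_A, ⟨T, hT, hG⟩, fun U₀ => ?_, fun U₀ hU₀ => ?_⟩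
  · rintro ⟨α, -, hα2, δ, hδ, hmono⟩
    obtain ⟨C, hC⟩ := DegenerateWave.exists_norm_incl_le hα2 hδ hmono
    exact DegenerateWave.completeSpace_energy hC
  · have hU := hG.isWeakSolution hT hd U₀
    exact ⟨_, hU, fun W hW => hG.weakSolution_unique hT hd D.reverse
      DegenerateWave.isAdjointPair_reverse hU hW⟩
  · have hU := hG.isStrongSolution hT ⟨U₀, hU₀⟩
    exact ⟨_, hU, fun W hW => hG.weakSolution_unique hT hd D.reverse
      DegenerateWave.isAdjointPair_reverse hU.isWeakSolution hW.isWeakSolution⟩
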